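/- Let $M$ be a smooth Hausdorff manifold (without boundary) of dimension $n\ge 1$ with a smooth Riemannian metric $g$ and Levi-Civita connection $\nabla$. For local coordinates $(x^j)$ on $M$ let $(x^j,u^j)$ be the induced coordinates on $TM$, $u=u^r\frac{\partial}{\partial x^r}$, and let $\Gamma^j_{rs}$ be the Christoffel symbols of $\nabla$. For $X=X^j\frac{\partial}{\partial x^j}\in T_xM$ the horizontal and vertical lifts of $X$ to $(x,u)\in TM$ are $$X^h=X^j\frac{\partial}{\partial x^j}-u^rX^s\Gamma^j_{rs}\frac{\partial}{\partial u^j},\qquad X^v=X^j\frac{\partial}{\partial u^j},$$ and the complete lift of a vector field $X=X^r\frac{\partial}{\partial x^r}$ on $M$ is the vector field on $TM$ $$X^C=X^r\frac{\partial}{\partial x^r}+u^s\frac{\partial X^r}{\partial x^s}\frac{\partial}{\partial u^r}.$$ A $g$-natural metric on $TM$ is a field $G$ of bilinear forms on $TM$ for which there are smooth functions $a_j,b_j:[0,\infty)\to\mathbb R$, $j=1,2,3$, such that for all $x\in M$ and $X,Y,u\in T_xM$, with $r^2=g_x(u,u)$, $$\begin{aligned}G_{(x,u)}(X^h,Y^h)&=(a_1+a_3)(r^2)\,g_x(X,Y)+(b_1+b_3)(r^2)\,g_x(X,u)g_x(Y,u),\\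 G_{(x,u)}(X^h,Y^v)&=G_{(x,u)}(X^v,Y^h)=a_2(r^2)\,g_x(X,Y)+b_2(r^2)\,g_x(X,u)g_x(Y,u),\\ G_{(x,u)}(X^v,Y^v)&=a_1(r^2)\,g_x(X,Y)+b_1(r^2)\,g_x(X,u)g_x(Y,u).\end{aligned}$$ Theorem. Let $X$ be a smooth vector field on $M$ and $f$ a function on $M$ such that $L_Xg=fg$, where $L$ denotes the Lie derivative. Let $G$ be a $g$-natural metric on $TM$ that is non-degenerate at every point of $TM$. Then $X^C$ is a Killing vector field of $(TM,G)$, i.e. $L_{X^C}G=0$, if and only if $f=0$ on $M$. -/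

import Mathlib

open scoped Manifold ContDiff

/-! ### Lie derivatives of `(0,2)`-tensor fields, nondegeneracy -/

section Tensor

variable {E : Type*} [NormedAddCommGroup E] [NormedSpace ℝ E]
  {H : Type*} [TopologicalSpace H] (I : ModelWithCorners ℝ E H)
  {N : Type*} [TopologicalSpace N] [ChartedSpace H N]

/-- The value `(L_X T)(Y, Z) = X (T (Y, Z)) - T ([X, Y], Z) - T (Y, [X, Z])` at `p` of the Lie
derivative of a `(0,2)`-tensor field `T` along `X`. -/
noncomputable def lieDerivTensor (X : ∀ p : N, TangentSpace I p)
    (T : ∀ p : N, TangentSpace I p →L[ℝ] TangentSpace I p →L[ℝ] ℝ)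
    (Y Z : ∀ p : N, TangentSpace I p) (p : N) : ℝ :=
  mvfderiv I (fun q : N => T q (Y q) (Z q)) p (X p)
    - T p (VectorField.mlieBracket I X Y p) (Z p)
    - T p (Y p) (VectorField.mlieBracket I X Z p)

/-- The equation `L_X T = S` between `(0,2)`-tensor fields: `(L_X T)(Y, Z) = S (Y, Z)` at every
point `p`, for all vector fields `Y`, `Z` that are smooth at `p`. -/
def LieDerivTensorEq [IsManifold I 1 N] (X : ∀ p : N, TangentSpace I p)
    (T S : ∀ p : N, TangentSpace I p →L[ℝ] TangentSpace I p →L[ℝ] ℝ) : Prop :=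
  ∀ (p : N) (Y Z : ∀ q : N, TangentSpace I q),
    ContMDiffAt I I.tangent ∞ (fun q => (⟨q, Y q⟩ : TangentBundle I N)) p →
    ContMDiffAt I I.tangent ∞ (fun q => (⟨q, Z q⟩ : TangentBundle I N)) p →
    lieDerivTensor I X T Y Z p = S p (Y p) (Z p)

/-- `X` is a Killing vector field of the metric `T`, i.e. `L_X T = 0`. -/
def IsKillingField [IsManifold I 1 N] (X : ∀ p : N, TangentSpace I p)
    (T : ∀ p : N, TangentSpace I p →L[ℝ] TangentSpace I p →L[ℝ] ℝ) : Prop :=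
  LieDerivTensorEq I X T (fun _ => 0)

/-- The bilinear form `T p` is nondegenerate at every point `p`. -/
def IsNondegenerateTensor
    (T : ∀ p : N, TangentSpace I p →L[ℝ] TangentSpace I p →L[ℝ] ℝ) : Prop :=
  ∀ (p : N) (ξ : TangentSpace I p), (∀ η : TangentSpace I p, T p ξ η = 0) → ξ = 0

end Tensor

/-! ### Lifts from `M` to `TM`

`M` is a smooth manifold without boundary, modelled on `E`. In Mathlib, the tangent space
`T_x M` is the model space `E`: a vector is given by its components in the preferred chart at `x`.
In the same way `T_{(x,u)} TM` is `E × E`: a tangent vector `ξ^j ∂/∂x^j + η^j ∂/∂u^j` is the pair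
`(ξ, η)` of its components in the coordinates `(x^j, u^j)` on `TM` induced by the preferred chart
at `x`. The lifts below are written in these coordinates. -/

section Lifts

variable {E : Type*} [NormedAddCommGroup E] [NormedSpace ℝ E]
  {M : Type*} [TopologicalSpace M] [ChartedSpace E M] [IsManifold 𝓘(ℝ, E) ∞ M]

/-- The coordinate expression `y ↦ (g_{ij}(y))` of the metric `g` in the preferred chart at `x`,
as a map from `E` to bilinear forms on `E`. -/
noncomputable def metricInChart
    (g : Bundle.ContMDiffRiemannianMetric 𝓘(ℝ, E) ∞ E (TangentSpace 𝓘(ℝ, E) : M → Type _))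
    (x : M) (y : E) : E →L[ℝ] E →L[ℝ] ℝ :=
  let D : E →L[ℝ] E := mfderiv 𝓘(ℝ, E) 𝓘(ℝ, E) (extChartAt 𝓘(ℝ, E) x).symm y
  let B : E →L[ℝ] E →L[ℝ] ℝ := g.inner ((extChartAt 𝓘(ℝ, E) x).symm y)
  B.bilinearComp D D

/-- The covector `Γ_{l,ij} v^i w^j = ½ (∂_i g_{jl} + ∂_j g_{il} - ∂_l g_{ij}) v^i w^j`, formed with
the Christoffel symbols of the first kind of `g` in the preferred chart at `x`, at the point `x`. -/
noncomputable def christoffelFirst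
    (g : Bundle.ContMDiffRiemannianMetric 𝓘(ℝ, E) ∞ E (TangentSpace 𝓘(ℝ, E) : M → Type _))
    (x : M) (v w : E) : E →L[ℝ] ℝ :=
  let dg : E →L[ℝ] E →L[ℝ] E →L[ℝ] ℝ :=
    fderiv ℝ (metricInChart g x) (extChartAt 𝓘(ℝ, E) x x)
  (1 / 2 : ℝ) • (dg v w + dg w v - (dg.flip v).flip w)

/-- The vector `Γ^k_{ij} v^i w^j = g^{kl} Γ_{l,ij} v^i w^j`, formed with the Christoffel symbols of
the Levi-Civita connection of `g` in the preferred chart at `x`, at the point `x`. The index is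
raised by the inverse of the map `E → E*` induced by `g`, which is an isomorphism in finite
dimension. -/
noncomputable def christoffel
    (g : Bundle.ContMDiffRiemannianMetric 𝓘(ℝ, E) ∞ E (TangentSpace 𝓘(ℝ, E) : M → Type _))
    (x : M) (v w : E) : E :=
  (metricInChart g x (extChartAt 𝓘(ℝ, E) x x)).inverse (christoffelFirst g x v w)

/-- The vertical lift `X^v = X^j ∂/∂u^j` of `X ∈ T_x M` to the point `p = (x, u)`. -/
def verticalLift (p : TangentBundle 𝓘(ℝ, E) M) (X : TangentSpace 𝓘(ℝ, E) p.proj) :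
    TangentSpace 𝓘(ℝ, E).tangent p :=
  ((0, X) : E × E)

/-- The horizontal lift `X^h = X^j ∂/∂x^j - u^r X^s Γ^j_{rs} ∂/∂u^j` of `X ∈ T_x M` to the point
`p = (x, u)`, with respect to the Levi-Civita connection of `g`. -/
noncomputable def horizontalLift
    (g : Bundle.ContMDiffRiemannianMetric 𝓘(ℝ, E) ∞ E (TangentSpace 𝓘(ℝ, E) : M → Type _))
    (p : TangentBundle 𝓘(ℝ, E) M) (X : TangentSpace 𝓘(ℝ, E) p.proj) :
    TangentSpace 𝓘(ℝ, E).tangent p :=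
  ((X, -christoffel g p.proj p.snd X) : E × E)

/-- The complete lift `X^C = X^r ∂/∂x^r + u^s ∂_s X^r ∂/∂u^r` to `TM` of a vector field `X` on `M`.
The components `X^r`, as functions of the coordinates of the preferred chart at `x`, are the
pullback of `X` under the inverse of that chart. -/
noncomputable def completeLift (X : ∀ x : M, TangentSpace 𝓘(ℝ, E) x)
    (p : TangentBundle 𝓘(ℝ, E) M) : TangentSpace 𝓘(ℝ, E).tangent p :=
  let Xcoord : E → E :=
    VectorField.mpullback 𝓘(ℝ, E) 𝓘(ℝ, E) (extChartAt 𝓘(ℝ, E) p.proj).symm X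
  ((X p.proj, fderiv ℝ Xcoord (extChartAt 𝓘(ℝ, E) p.proj p.proj) p.snd) : E × E)

/-- `G` is a `g`-natural metric on `TM`: there are smooth functions `a₁, a₂, a₃, b₁, b₂, b₃` on
`[0, ∞)` such that, at every `(x, u) ∈ TM` and with `r² = g_x(u, u)`, for all `X, Y ∈ T_x M`,
* `G(X^h, Y^h) = (a₁ + a₃)(r²) g(X, Y) + (b₁ + b₃)(r²) g(X, u) g(Y, u)`,
* `G(X^h, Y^v) = G(X^v, Y^h) = a₂(r²) g(X, Y) + b₂(r²) g(X, u) g(Y, u)`,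
* `G(X^v, Y^v) = a₁(r²) g(X, Y) + b₁(r²) g(X, u) g(Y, u)`. -/
def IsGNatural
    (g : Bundle.ContMDiffRiemannianMetric 𝓘(ℝ, E) ∞ E (TangentSpace 𝓘(ℝ, E) : M → Type _))
    (G : ∀ p : TangentBundle 𝓘(ℝ, E) M, TangentSpace 𝓘(ℝ, E).tangent p →L[ℝ]
      TangentSpace 𝓘(ℝ, E).tangent p →L[ℝ] ℝ) : Prop :=
  ∃ a₁ a₂ a₃ b₁ b₂ b₃ : ℝ → ℝ,
    (ContDiffOn ℝ ∞ a₁ (Set.Ici 0) ∧ ContDiffOn ℝ ∞ a₂ (Set.Ici 0) ∧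
      ContDiffOn ℝ ∞ a₃ (Set.Ici 0) ∧ ContDiffOn ℝ ∞ b₁ (Set.Ici 0) ∧
      ContDiffOn ℝ ∞ b₂ (Set.Ici 0) ∧ ContDiffOn ℝ ∞ b₃ (Set.Ici 0)) ∧
    ∀ (x : M) (u X Y : TangentSpace 𝓘(ℝ, E) x),
      let p : TangentBundle 𝓘(ℝ, E) M := ⟨x, u⟩
      let t : ℝ := g.inner x u u
      G p (horizontalLift g p X) (horizontalLift g p Y) =
          (a₁ t + a₃ t) * g.inner x X Y + (b₁ t + b₃ t) * (g.inner x X u * g.inner x Y u) ∧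
      G p (horizontalLift g p X) (verticalLift p Y) =
          a₂ t * g.inner x X Y + b₂ t * (g.inner x X u * g.inner x Y u) ∧
      G p (verticalLift p X) (horizontalLift g p Y) =
          a₂ t * g.inner x X Y + b₂ t * (g.inner x X u * g.inner x Y u) ∧
      G p (verticalLift p X) (verticalLift p Y) =
          a₁ t * g.inner x X Y + b₁ t * (g.inner x X u * g.inner x Y u)

end Lifts

/-! The flow of `X^C` is the tangent map of the flow of `X`. If `X` is Killing, its flow preserves
`g`, hence the Levi-Civita connection, the splitting into horizontal and vertical parts and the
function r², hence every `g`-natural metric. Conversely, if `L_X g = f g`, then `X^C` is tangent to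
the zero section, and there all terms involving Γ or the `b_j` vanish, because they contain the
fibre coordinate u = 0. What remains is a combination of copies of `g` with coefficients `a_j(0)`,
so `L_{X^C} G = f G` at (x, 0). If `X^C` is Killing, then f(x) G = 0 on T_{(x,0)}TM; a
non-degenerate form on a nonzero space is not zero, so f(x) = 0.

Both directions come from one infinitesimal computation, `hasDirDerivAt_naturalForm`: `L_{X^C} G = c
G` at (x, u) as soon as `L_X g = c g` at x, `c u = 0`, and the Lie derivative of the connection
along `X` vanishes when one argument is u. At u = 0 the last two conditions are trivial; for f = 0
the last one is `lieDeriv_localChristoffel_eq_zero`. `lieDerivTensor_completeLift` joins the two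
cases.

The remaining work is independence of coordinates. The tangent space at each point is trivialised by
the preferred chart at that same point, whereas a Lie derivative compares neighbouring points in one
chart. `naturalForm_chart`, `vectorInChart_completeLift` and `localLieDeriv_metricInChart` give the
expressions of `G`, `X^C` and `L_X g = f g` throughout a single chart; the first rests on the
transformation law of the Christoffel symbols. -/

/-! ### Tensor calculus on an open subset of the model space -/

section LocalCalculus

set_option maxSynthPendingDepth 3

open Filter Topology

variable {E : Type*} [NormedAddCommGroup E] [NormedSpace ℝ E]

/-- The Christoffel symbols of the first kind, as a trilinear map, formed from the derivative `dg`
of a metric. -/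
noncomputable def christoffelFirstCLM (dg : E →L[ℝ] E →L[ℝ] E →L[ℝ] ℝ) :
    E →L[ℝ] E →L[ℝ] E →L[ℝ] ℝ :=
  (1 / 2 : ℝ) • (dg + dg.flip -
    (ContinuousLinearMap.flipₗᵢ ℝ E E ℝ).toContinuousLinearEquiv.toContinuousLinearMap.comp dg.flip)

lemma christoffelFirstCLM_apply (dg : E →L[ℝ] E →L[ℝ] E →L[ℝ] ℝ) (v w z : E) :
    christoffelFirstCLM dg v w z = 1 / 2 * (dg v w z + dg w v z - dg z v w) := by
  simp [christoffelFirstCLM]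

/-- The Christoffel symbols of the second kind of the local metric `γ` at `y`. -/
noncomputable def localChristoffel (γ : E → E →L[ℝ] E →L[ℝ] ℝ) (y : E) : E →L[ℝ] E →L[ℝ] E :=
  (ContinuousLinearMap.compL ℝ E (E →L[ℝ] ℝ) E (γ y).inverse).comp
    (christoffelFirstCLM (fderiv ℝ γ y))

lemma localChristoffel_apply (γ : E → E →L[ℝ] E →L[ℝ] ℝ) (y v w : E) :
    localChristoffel γ y v w = (γ y).inverse (christoffelFirstCLM (fderiv ℝ γ y) v w) := rfl

/-- The Koszul formula in coordinates. Identities for Γ are proved by pairing with γ and using this,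
so the derivative of the inverse metric is never computed. -/
lemma apply_localChristoffel {γ : E → E →L[ℝ] E →L[ℝ] ℝ} {y : E} (hinv : (γ y).IsInvertible)
    (v w z : E) :
    γ y (localChristoffel γ y v w) z =
      1 / 2 * (fderiv ℝ γ y v w z + fderiv ℝ γ y w v z - fderiv ℝ γ y z v w) := by
  rw [localChristoffel_apply, ← christoffelFirstCLM_apply, hinv.self_apply_inverse]

lemma differentiableAt_localChristoffel [CompleteSpace E] {γ : E → E →L[ℝ] E →L[ℝ] ℝ} {y : E}
    (hγ : ContDiffAt ℝ 2 γ y) (hinv : (γ y).IsInvertible) :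
    DifferentiableAt ℝ (localChristoffel γ) y := by
  have h1 : DifferentiableAt ℝ (fun y => (γ y).inverse) y :=
    ((hinv.contDiffAt_map_inverse (n := 1)).differentiableAt one_ne_zero).comp y
      (hγ.differentiableAt two_ne_zero)
  have h2 : DifferentiableAt ℝ (fderiv ℝ γ) y :=
    (hγ.fderiv_right (m := 1) (by norm_num)).differentiableAt one_ne_zero
  have h2' : DifferentiableAt ℝ (fun y => (fderiv ℝ γ y).flip) y :=
    (ContinuousLinearMap.flipₗᵢ ℝ E E (E →L[ℝ] ℝ)).differentiableAt.comp y h2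
  have h3 : DifferentiableAt ℝ (fun y => christoffelFirstCLM (fderiv ℝ γ y)) y :=
    ((h2.add h2').sub ((differentiableAt_const _).clm_comp h2')).const_smul (1 / 2 : ℝ)
  exact ((ContinuousLinearMap.compL ℝ E (E →L[ℝ] ℝ) E).differentiableAt.comp y h1).clm_comp h3

/-- The Lie derivative along `X` of the `(0,2)`-tensor field `γ` on the model space. -/
noncomputable def localLieDeriv (X : E → E) (γ : E → E →L[ℝ] E →L[ℝ] ℝ) (y a b : E) : ℝ :=
  fderiv ℝ γ y (X y) a b + γ y (fderiv ℝ X y a) b + γ y a (fderiv ℝ X y b)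

/-- Differentiation of a pulled back bilinear form. -/
lemma fderiv_pullback_form {γ₁ γ₂ : E → E →L[ℝ] E →L[ℝ] ℝ} {φ : E → E} {y : E}
    (hφ : ContDiffAt ℝ 2 φ y) (hγ₁ : DifferentiableAt ℝ γ₁ y) (hγ₂ : DifferentiableAt ℝ γ₂ (φ y))
    (h : ∀ᶠ y' in 𝓝 y, ∀ a b, γ₁ y' a b = γ₂ (φ y') (fderiv ℝ φ y' a) (fderiv ℝ φ y' b))
    (c a b : E) :
    fderiv ℝ γ₁ y c a b = fderiv ℝ γ₂ (φ y) (fderiv ℝ φ y c) (fderiv ℝ φ y a) (fderiv ℝ φ y b)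
      + γ₂ (φ y) (fderiv ℝ (fderiv ℝ φ) y c a) (fderiv ℝ φ y b)
      + γ₂ (φ y) (fderiv ℝ φ y a) (fderiv ℝ (fderiv ℝ φ) y c b) := by
  have hφ1 := (hφ.differentiableAt two_ne_zero).hasFDerivAt
  have hφ2 := ((hφ.fderiv_right (m := 1) (by norm_num)).differentiableAt one_ne_zero).hasFDerivAt
  have h1 := (hγ₁.hasFDerivAt.clm_apply (hasFDerivAt_const a y)).clm_apply (hasFDerivAt_const b y)
  have ha := hφ2.clm_apply (hasFDerivAt_const a y)
  have hb := hφ2.clm_apply (hasFDerivAt_const b y)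
  have h2 := ((hγ₂.hasFDerivAt.comp y hφ1).clm_apply ha).clm_apply hb
  have h3 := h1.congr_of_eventuallyEq (f₁ := fun y' =>
    γ₂ (φ y') (fderiv ℝ φ y' a) (fderiv ℝ φ y' b)) (h.mono fun y' hy' => (hy' a b).symm)
  have := congrArg (fun L : E →L[ℝ] ℝ => L c) (h3.unique h2)
  simpa [add_comm, add_left_comm, add_assoc] using this

lemma second_fderiv_symm {φ : E → E} {y : E} (hφ : ContDiffAt ℝ 2 φ y) (v w : E) :
    fderiv ℝ (fderiv ℝ φ) y v w = fderiv ℝ (fderiv ℝ φ) y w v :=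
  (hφ.isSymmSndFDerivAt (by simp)) v w

/-- The transformation law of the Christoffel symbols. -/
lemma localChristoffel_pullback {γ₁ γ₂ : E → E →L[ℝ] E →L[ℝ] ℝ} {φ : E → E} {y : E}
    (hφ : ContDiffAt ℝ 2 φ y) (hγ₁ : DifferentiableAt ℝ γ₁ y) (hγ₂ : DifferentiableAt ℝ γ₂ (φ y))
    (h : ∀ᶠ y' in 𝓝 y, ∀ a b, γ₁ y' a b = γ₂ (φ y') (fderiv ℝ φ y' a) (fderiv ℝ φ y' b))
    (hinv₁ : (γ₁ y).IsInvertible) (hinv₂ : (γ₂ (φ y)).IsInvertible)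
    (hφinv : Function.Surjective (fderiv ℝ φ y))
    (hsymm : ∀ a b, γ₂ (φ y) a b = γ₂ (φ y) b a) (v w : E) :
    fderiv ℝ φ y (localChristoffel γ₁ y v w) = fderiv ℝ (fderiv ℝ φ) y v w
      + localChristoffel γ₂ (φ y) (fderiv ℝ φ y v) (fderiv ℝ φ y w) := by
  -- Lower the index and test only against vectors Dφ z. Both sides become Koszul combinations of
  -- first derivatives; by the symmetry of D²φ the inhomogeneous terms reduce to twice γ₂(D²φ(v, w),
  -- Dφ z).
  apply hinv₂.injective
  ext z'
  obtain ⟨z, rfl⟩ := hφinv z'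
  rw [← h.self_of_nhds, apply_localChristoffel hinv₁, map_add, add_apply,
    apply_localChristoffel hinv₂]
  simp only [fderiv_pullback_form hφ hγ₁ hγ₂ h]
  rw [second_fderiv_symm hφ w v, second_fderiv_symm hφ z v, second_fderiv_symm hφ z w,
    hsymm _ (fderiv ℝ (fderiv ℝ φ) y w z), hsymm _ (fderiv ℝ (fderiv ℝ φ) y v z)]
  ring

/-- Differentiation of a vector field transported by `φ`. -/
lemma fderiv_pushforward {φ X₁ X₂ : E → E} {y : E}
    (hφ : ContDiffAt ℝ 2 φ y) (hX₁ : DifferentiableAt ℝ X₁ y) (hX₂ : DifferentiableAt ℝ X₂ (φ y))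
    (hX : ∀ᶠ y' in 𝓝 y, X₂ (φ y') = fderiv ℝ φ y' (X₁ y')) (a : E) :
    fderiv ℝ X₂ (φ y) (fderiv ℝ φ y a)
      = fderiv ℝ (fderiv ℝ φ) y a (X₁ y) + fderiv ℝ φ y (fderiv ℝ X₁ y a) := by
  have hφ1 := (hφ.differentiableAt two_ne_zero).hasFDerivAt
  have hφ2 := ((hφ.fderiv_right (m := 1) (by norm_num)).differentiableAt one_ne_zero).hasFDerivAt
  have h1 := hφ2.clm_apply hX₁.hasFDerivAt
  have h2 := (hX₂.hasFDerivAt.comp y hφ1).congr_of_eventuallyEq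
    (hX.mono fun y' hy' => hy'.symm)
  have := congrArg (fun L : E →L[ℝ] E => L a) (h2.unique h1)
  simpa [add_comm] using this

/-- Naturality of the Lie derivative under a change of coordinates. -/
lemma localLieDeriv_pullback {γ₁ γ₂ : E → E →L[ℝ] E →L[ℝ] ℝ} {φ X₁ X₂ : E → E} {y : E}
    (hφ : ContDiffAt ℝ 2 φ y) (hγ₁ : DifferentiableAt ℝ γ₁ y) (hγ₂ : DifferentiableAt ℝ γ₂ (φ y))
    (h : ∀ᶠ y' in 𝓝 y, ∀ a b, γ₁ y' a b = γ₂ (φ y') (fderiv ℝ φ y' a) (fderiv ℝ φ y' b))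
    (hX₁ : DifferentiableAt ℝ X₁ y) (hX₂ : DifferentiableAt ℝ X₂ (φ y))
    (hX : ∀ᶠ y' in 𝓝 y, X₂ (φ y') = fderiv ℝ φ y' (X₁ y')) (a b : E) :
    localLieDeriv X₁ γ₁ y a b
      = localLieDeriv X₂ γ₂ (φ y) (fderiv ℝ φ y a) (fderiv ℝ φ y b) := by
  unfold localLieDeriv
  rw [fderiv_pullback_form hφ hγ₁ hγ₂ h, h.self_of_nhds, h.self_of_nhds, hX.self_of_nhds,
    fderiv_pushforward hφ hX₁ hX₂ hX, fderiv_pushforward hφ hX₁ hX₂ hX,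
    second_fderiv_symm hφ a, second_fderiv_symm hφ b]
  simp only [map_add, add_apply]
  ring

/-- The Levi-Civita connection of `γ` is invariant under a vector field that preserves `γ`. -/
lemma lieDeriv_localChristoffel_eq_zero [CompleteSpace E]
    {γ : E → E →L[ℝ] E →L[ℝ] ℝ} {X : E → E} {y : E}
    (hγ : ContDiffAt ℝ 2 γ y) (hX : ContDiffAt ℝ 2 X y)
    (hinv : ∀ᶠ y' in 𝓝 y, (γ y').IsInvertible)
    (hsymm : ∀ᶠ y' in 𝓝 y, ∀ a b, γ y' a b = γ y' b a)
    (h : ∀ᶠ y' in 𝓝 y, ∀ a b, localLieDeriv X γ y' a b = 0) (v w : E) :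
    fderiv ℝ (localChristoffel γ) y (X y) v w + localChristoffel γ y (fderiv ℝ X y v) w
      + localChristoffel γ y v (fderiv ℝ X y w) + fderiv ℝ (fderiv ℝ X) y v w
      - fderiv ℝ X y (localChristoffel γ y v w) = 0 := by
  have hγ1 := (hγ.differentiableAt two_ne_zero).hasFDerivAt
  have hγ2 := ((hγ.fderiv_right (m := 1) (by norm_num)).differentiableAt one_ne_zero).hasFDerivAt
  have hX1 := (hX.differentiableAt two_ne_zero).hasFDerivAt
  have hX2 := ((hX.fderiv_right (m := 1) (by norm_num)).differentiableAt one_ne_zero).hasFDerivAt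
  have hΓ := (differentiableAt_localChristoffel hγ hinv.self_of_nhds).hasFDerivAt
  have c (a : E) : HasFDerivAt (fun _ : E => a) (0 : E →L[ℝ] E) y := hasFDerivAt_const a y
  -- The derivative in direction u of the identity `L_X γ = 0`, which is why that identity is needed
  -- in a neighbourhood.
  have key (u a b : E) :
      fderiv ℝ (fderiv ℝ γ) y u (X y) a b + fderiv ℝ γ y (fderiv ℝ X y u) a b
      + fderiv ℝ γ y u (fderiv ℝ X y a) b + γ y (fderiv ℝ (fderiv ℝ X) y u a) b
      + fderiv ℝ γ y u a (fderiv ℝ X y b) + γ y a (fderiv ℝ (fderiv ℝ X) y u b) = 0 := by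
    have h1 := (((hγ2.clm_apply hX1).clm_apply (c a)).clm_apply (c b)).add
      ((hγ1.clm_apply (hX2.clm_apply (c a))).clm_apply (c b)) |>.add
      ((hγ1.clm_apply (c a)).clm_apply (hX2.clm_apply (c b)))
    have h2 : HasFDerivAt (fun y' => localLieDeriv X γ y' a b) (0 : E →L[ℝ] ℝ) y :=
      (hasFDerivAt_const (0 : ℝ) y).congr_of_eventuallyEq (h.mono fun y' hy' => hy' a b)
    have := congrArg (fun L : E →L[ℝ] ℝ => L u) (h1.unique h2)
    simp only [add_apply, ContinuousLinearMap.comp_apply,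
      ContinuousLinearMap.flip_apply, zero_apply, map_zero, zero_add] at this
    linarith
  apply hinv.self_of_nhds.injective
  ext z
  -- Differentiate γ(Γ(v, w), z) along X in two ways: by the product rule, and through the Koszul
  -- formula.
  have h1 := (hγ1.clm_apply ((hΓ.clm_apply (c v)).clm_apply (c w))).clm_apply (c z)
  have h2 := ((((hγ2.clm_apply (c v)).clm_apply (c w)).clm_apply (c z)).add
    (((hγ2.clm_apply (c w)).clm_apply (c v)).clm_apply (c z)) |>.sub
    (((hγ2.clm_apply (c z)).clm_apply (c v)).clm_apply (c w))).const_mul (1 / 2 : ℝ)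
  have h3 := h2.congr_of_eventuallyEq
    (f₁ := fun y' => γ y' (localChristoffel γ y' v w) z)
    (hinv.mono fun y' hy' => apply_localChristoffel hy' v w z)
  have h4 := congrArg (fun L : E →L[ℝ] ℝ => L (X y)) (h1.unique h3)
  have h5 := h.self_of_nhds (localChristoffel γ y v w) z
  have hs := hsymm.self_of_nhds
  -- The Koszul combination e1 + e2 - e3 leaves 2 γ(D²X(v, w), z) from the second derivatives of X,
  -- while its second derivatives of γ match those in h4. The term with DX(Γ(v, w)) is supplied by
  -- h5.
  have e1 := key v w z
  have e2 := key w v z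
  have e3 := key z v w
  have s (a b : E) := second_fderiv_symm hX a b
  have sγ (a b : E) : fderiv ℝ (fderiv ℝ γ) y a b = fderiv ℝ (fderiv ℝ γ) y b a :=
    hγ.isSymmSndFDerivAt (by simp) a b
  unfold localLieDeriv at h5
  simp only [map_add, map_sub, map_zero, add_apply,
      sub_apply, ContinuousLinearMap.comp_apply, apply_localChristoffel
      hinv.self_of_nhds, smul_apply, smul_eq_mul,
      ContinuousLinearMap.flip_apply, zero_apply, map_zero, zero_add,
      add_zero] at h4 h5 e1 e2 e3 ⊢
  rw [sγ v, hs w] at e1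
  rw [sγ w, s w v, hs v] at e2
  rw [sγ z, s z v, s z w, hs v] at e3
  linarith

end LocalCalculus

/-! ### Natural metrics on the tangent space of the model space -/

section NaturalForm

set_option maxSynthPendingDepth 3

open Filter Topology

/-- `F` is differentiable at `z` with directional derivative `d` along `V`. -/
def HasDirDerivAt {W R : Type*} [NormedAddCommGroup W] [NormedSpace ℝ W] [NormedAddCommGroup R]
    [NormedSpace ℝ R] (F : W → R) (d : R) (z V : W) : Prop :=
  DifferentiableAt ℝ F z ∧ fderiv ℝ F z V = d

namespace HasDirDerivAt

variable {W R : Type*} [NormedAddCommGroup W] [NormedSpace ℝ W] [NormedAddCommGroup R]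
    [NormedSpace ℝ R] {z V : W}

lemma _root_.HasFDerivAt.hasDirDerivAt {F : W → R} {F' : W →L[ℝ] R} (h : HasFDerivAt F F' z)
    (V : W) : HasDirDerivAt F (F' V) z V :=
  ⟨h.differentiableAt, by rw [h.fderiv]⟩

lemma congr_deriv {F : W → R} {d d' : R} (h : HasDirDerivAt F d z V) (hd : d = d') :
    HasDirDerivAt F d' z V := hd ▸ h

lemma add {F F' : W → R} {d d' : R} (h : HasDirDerivAt F d z V) (h' : HasDirDerivAt F' d' z V) :
    HasDirDerivAt (fun z => F z + F' z) (d + d') z V :=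
  ((h.1.hasFDerivAt.add h'.1.hasFDerivAt).hasDirDerivAt V).congr_deriv (by simp [h.2, h'.2])

lemma mul {F F' : W → ℝ} {d d' : ℝ} (h : HasDirDerivAt F d z V) (h' : HasDirDerivAt F' d' z V) :
    HasDirDerivAt (fun z => F z * F' z) (F z * d' + F' z * d) z V :=
  ((h.1.hasFDerivAt.mul h'.1.hasFDerivAt).hasDirDerivAt V).congr_deriv (by simp [h.2, h'.2])

lemma clm_apply {S : Type*} [NormedAddCommGroup S] [NormedSpace ℝ S] {A : W → R →L[ℝ] S}
    {F : W → R} {d : R} {A' : R →L[ℝ] S} (hA : HasDirDerivAt A A' z V)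
    (h : HasDirDerivAt F d z V) :
    HasDirDerivAt (fun z => A z (F z)) (A z d + A' (F z)) z V :=
  ((hA.1.hasFDerivAt.clm_apply h.1.hasFDerivAt).hasDirDerivAt V).congr_deriv
    (by simp [h.2, hA.2])

/-- The coefficients are smooth on [0, ∞) only, and r² = 0 on the zero section. Since t takes
nonnegative values near z, the one-sided derivative of a is enough for the chain rule. -/
lemma comp_of_eq_zero {t : W → ℝ} {a : ℝ → ℝ} (ht : HasDirDerivAt t 0 z V)
    (ht0 : ∀ᶠ z' in 𝓝 z, 0 ≤ t z') (ha : DifferentiableOn ℝ a (Set.Ici 0)) :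
    HasDirDerivAt (fun z => a (t z)) 0 z V := by
  have h1 := (ha (t z) ht0.self_of_nhds).hasFDerivWithinAt
  have h2 : HasFDerivAt (fun z => a (t z)) _ z :=
    HasFDerivWithinAt.comp_hasFDerivAt z h1 ht.1.hasFDerivAt ht0
  exact (h2.hasDirDerivAt V).congr_deriv (by simp [ht.2])

end HasDirDerivAt

variable {E : Type*} [NormedAddCommGroup E] [NormedSpace ℝ E]

/-- The vertical part of `ζ` at a point with fibre coordinate `w`, for the connection `Γ`. -/
noncomputable def connector (Γ : E →L[ℝ] E →L[ℝ] E) (w : E) (ζ : E × E) : E := ζ.2 + Γ w ζ.1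

/-- The expression of a natural metric in terms of the value `γ` of the metric, the Christoffel
symbols `Γ` and the fibre coordinate `w`. -/
noncomputable def naturalForm (a₁ a₂ a₃ b₁ b₂ b₃ : ℝ → ℝ) (γ : E →L[ℝ] E →L[ℝ] ℝ)
    (Γ : E →L[ℝ] E →L[ℝ] E) (w : E) (ζ ζ' : E × E) : ℝ :=
  ((a₁ (γ w w) + a₃ (γ w w)) * γ ζ.1 ζ'.1 + (b₁ (γ w w) + b₃ (γ w w)) * (γ ζ.1 w * γ ζ'.1 w))
  + (a₂ (γ w w) * γ ζ.1 (connector Γ w ζ') + b₂ (γ w w) * (γ ζ.1 w * γ (connector Γ w ζ') w))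
  + (a₂ (γ w w) * γ (connector Γ w ζ) ζ'.1 + b₂ (γ w w) * (γ (connector Γ w ζ) w * γ ζ'.1 w))
  + (a₁ (γ w w) * γ (connector Γ w ζ) (connector Γ w ζ')
    + b₁ (γ w w) * (γ (connector Γ w ζ) w * γ (connector Γ w ζ') w))

/-- The complete lift of a vector field on the model space. -/
noncomputable def localCompleteLift (X : E → E) (z : E × E) : E × E :=
  (X z.1, fderiv ℝ X z.1 z.2)

/-- Read for a map instead of a vector field, (X(x), DX(x) u) is a tangent map. The formula thus
serves both the bracket with `X^C` and the coordinate changes of TM. -/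
lemma fderiv_localCompleteLift {X : E → E} {z : E × E} (hX : ContDiffAt ℝ 2 X z.1) (ζ : E × E) :
    fderiv ℝ (localCompleteLift X) z ζ =
      (fderiv ℝ X z.1 ζ.1, fderiv ℝ (fderiv ℝ X) z.1 ζ.1 z.2 + fderiv ℝ X z.1 ζ.2) := by
  have h1 := (hX.differentiableAt two_ne_zero).hasFDerivAt.comp z hasFDerivAt_fst
  have h2 := ((hX.fderiv_right (m := 1) (by norm_num)).differentiableAt
    one_ne_zero).hasFDerivAt.comp z hasFDerivAt_fst
  have h3 : HasFDerivAt (localCompleteLift X) _ z :=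
    h1.prodMk (h2.clm_apply (hasFDerivAt_snd (𝕜 := ℝ) (E := E) (F := E)))
  rw [h3.fderiv]
  simp [add_comm]

/-- The Lie derivative of a natural metric along a complete lift. -/
lemma hasDirDerivAt_naturalForm {a₁ a₂ a₃ b₁ b₂ b₃ : ℝ → ℝ}
    (ha₁ : DifferentiableOn ℝ a₁ (Set.Ici 0)) (ha₂ : DifferentiableOn ℝ a₂ (Set.Ici 0))
    (ha₃ : DifferentiableOn ℝ a₃ (Set.Ici 0)) (hb₁ : DifferentiableOn ℝ b₁ (Set.Ici 0))
    (hb₂ : DifferentiableOn ℝ b₂ (Set.Ici 0)) (hb₃ : DifferentiableOn ℝ b₃ (Set.Ici 0))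
    {γ : E → E →L[ℝ] E →L[ℝ] ℝ} {Γ : E → E →L[ℝ] E →L[ℝ] E} {X : E → E} {Y Z : E × E → E × E}
    {z : E × E} {c : ℝ}
    (hγ : DifferentiableAt ℝ γ z.1) (hΓ : DifferentiableAt ℝ Γ z.1) (hX : ContDiffAt ℝ 2 X z.1)
    (hY : DifferentiableAt ℝ Y z) (hZ : DifferentiableAt ℝ Z z)
    (hpos : ∀ᶠ y in 𝓝 z.1, ∀ v, 0 ≤ γ y v v)
    (hL : ∀ a b, localLieDeriv X γ z.1 a b = c * γ z.1 a b)
    (hc : c • z.2 = 0)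
    (hLΓ : ∀ ξ, fderiv ℝ Γ z.1 (X z.1) z.2 ξ + Γ z.1 (fderiv ℝ X z.1 z.2) ξ
      + Γ z.1 z.2 (fderiv ℝ X z.1 ξ) + fderiv ℝ (fderiv ℝ X) z.1 z.2 ξ
      - fderiv ℝ X z.1 (Γ z.1 z.2 ξ) = 0) :
    HasDirDerivAt
      (fun z => naturalForm a₁ a₂ a₃ b₁ b₂ b₃ (γ z.1) (Γ z.1) z.2 (Y z) (Z z))
      (c * naturalForm a₁ a₂ a₃ b₁ b₂ b₃ (γ z.1) (Γ z.1) z.2 (Y z) (Z z)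
        + naturalForm a₁ a₂ a₃ b₁ b₂ b₃ (γ z.1) (Γ z.1) z.2
          (VectorField.lieBracket ℝ (localCompleteLift X) Y z) (Z z)
        + naturalForm a₁ a₂ a₃ b₁ b₂ b₃ (γ z.1) (Γ z.1) z.2
          (Y z) (VectorField.lieBracket ℝ (localCompleteLift X) Z z))
      z (localCompleteLift X z) := by
  set V := localCompleteLift X with hV
  set D := fderiv ℝ X z.1 with hD
  have hγ' : HasDirDerivAt (fun z : E × E => γ z.1) (fderiv ℝ γ z.1 (X z.1)) z (V z) :=
    (hγ.hasFDerivAt.comp z hasFDerivAt_fst).hasDirDerivAt (V z)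
  have hΓ' : HasDirDerivAt (fun z : E × E => Γ z.1) (fderiv ℝ Γ z.1 (X z.1)) z (V z) :=
    (hΓ.hasFDerivAt.comp z hasFDerivAt_fst).hasDirDerivAt (V z)
  -- Every ingredient α gets a derivative of the form D α + δ: the part D α is absorbed by `L_X γ =
  -- c γ`, and δ comes from the bracket. The fibre coordinate has δ = 0.
  have hw : HasDirDerivAt (fun z : E × E => z.2) (D z.2 + 0) z (V z) := by
    rw [add_zero]
    exact (hasFDerivAt_snd (𝕜 := ℝ) (E := E) (F := E) (p := z)).hasDirDerivAt (V z)
  have base {Y : E × E → E × E} (hY : DifferentiableAt ℝ Y z) :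
      HasDirDerivAt (fun z => (Y z).1)
        (D (Y z).1 + (VectorField.lieBracket ℝ V Y z).1) z (V z) := by
    refine ((hasFDerivAt_fst.comp z hY.hasFDerivAt).hasDirDerivAt (V z)).congr_deriv ?_
    simp [VectorField.lieBracket, hV, fderiv_localCompleteLift hX, hD]
  -- Here `hLΓ` enters: it says that the connector intertwines the bracket with `X^C`, so vertical
  -- parts have the same form D α + δ as base components.
  have vert {Y : E × E → E × E} (hY : DifferentiableAt ℝ Y z) :
      HasDirDerivAt (fun z => connector (Γ z.1) z.2 (Y z))
        (D (connector (Γ z.1) z.2 (Y z))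
          + connector (Γ z.1) z.2 (VectorField.lieBracket ℝ V Y z)) z (V z) := by
    have h1 := (hasFDerivAt_snd.comp z hY.hasFDerivAt).hasDirDerivAt (V z)
    refine (h1.add ((hΓ'.clm_apply hw).clm_apply (base hY))).congr_deriv ?_
    have h2 := hLΓ (Y z).1
    rw [second_fderiv_symm hX] at h2
    simp only [connector, VectorField.lieBracket, hV, fderiv_localCompleteLift hX, Prod.fst_sub,
      Prod.snd_sub, map_add, map_sub, add_apply, add_zero,
      ContinuousLinearMap.comp_apply, ContinuousLinearMap.coe_snd', ← hD] at h2 ⊢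
    rw [← sub_eq_zero, ← h2]
    abel
  have pair {α β : E × E → E} {δ ε : E} (hα : HasDirDerivAt α (D (α z) + δ) z (V z))
      (hβ : HasDirDerivAt β (D (β z) + ε) z (V z)) :
      HasDirDerivAt (fun z => γ z.1 (α z) (β z))
        (c * γ z.1 (α z) (β z) + γ z.1 δ (β z) + γ z.1 (α z) ε) z (V z) := by
    refine ((hγ'.clm_apply hα).clm_apply hβ).congr_deriv ?_
    rw [← hL]
    simp only [localLieDeriv, map_add, add_apply, ← hD]
    ring
  -- Because c w = 0, pairings with w, and with them r², lose the conformal factor; the coefficient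
  -- functions then have derivative 0 along `X^C`.
  have hc' (a : E) : c * γ z.1 a z.2 = 0 := by
    rw [← smul_eq_mul, ← map_smul, hc, map_zero]
  have pairw {α : E × E → E} {δ : E} (hα : HasDirDerivAt α (D (α z) + δ) z (V z)) :
      HasDirDerivAt (fun z => γ z.1 (α z) z.2) (γ z.1 δ z.2) z (V z) :=
    (pair hα hw).congr_deriv (by simp [hc'])
  have coef {a : ℝ → ℝ} (ha : DifferentiableOn ℝ a (Set.Ici 0)) :
      HasDirDerivAt (fun z : E × E => a (γ z.1 z.2 z.2)) 0 z (V z) :=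
    ((pairw hw).congr_deriv (by simp)).comp_of_eq_zero
      ((continuousAt_fst.eventually hpos).mono fun z' h => h z'.2) ha
  have term {a b : ℝ → ℝ} (ha : HasDirDerivAt (fun z : E × E => a (γ z.1 z.2 z.2)) 0 z (V z))
      (hb : HasDirDerivAt (fun z : E × E => b (γ z.1 z.2 z.2)) 0 z (V z)) {α β : E × E → E}
      {δ ε : E} (hα : HasDirDerivAt α (D (α z) + δ) z (V z))
      (hβ : HasDirDerivAt β (D (β z) + ε) z (V z)) :=
    (ha.mul (pair hα hβ)).add (hb.mul ((pairw hα).mul (pairw hβ)))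
  have h11 := term (a := fun t => a₁ t + a₃ t) (b := fun t => b₁ t + b₃ t)
    (((coef ha₁).add (coef ha₃)).congr_deriv (add_zero 0))
    (((coef hb₁).add (coef hb₃)).congr_deriv (add_zero 0)) (base hY) (base hZ)
  refine (((h11.add (term (coef ha₂) (coef hb₂) (base hY) (vert hZ))).add
    (term (coef ha₂) (coef hb₂) (vert hY) (base hZ))).add
    (term (coef ha₁) (coef hb₁) (vert hY) (vert hZ))).congr_deriv ?_
  simp only [naturalForm]
  generalize VectorField.lieBracket ℝ V Y z = P
  generalize VectorField.lieBracket ℝ V Z z = Q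
  -- The target has the factor c also on the b-terms, where the derivative has none. These surplus
  -- terms contain a pairing with w and vanish by hc'.
  linear_combination
    - (b₁ (γ z.1 z.2 z.2) + b₃ (γ z.1 z.2 z.2)) * γ z.1 (Z z).1 z.2 * hc' (Y z).1
    - b₂ (γ z.1 z.2 z.2) * γ z.1 (connector (Γ z.1) z.2 (Z z)) z.2 * hc' (Y z).1
    - b₂ (γ z.1 z.2 z.2) * γ z.1 (connector (Γ z.1) z.2 (Y z)) z.2 * hc' (Z z).1
    - b₁ (γ z.1 z.2 z.2) * γ z.1 (connector (Γ z.1) z.2 (Z z)) z.2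
      * hc' (connector (Γ z.1) z.2 (Y z))

end NaturalForm

/-! ### Lie derivatives in the preferred chart -/

section LieDerivInChart

set_option maxSynthPendingDepth 3

open Filter Topology

variable {E : Type*} [NormedAddCommGroup E] [NormedSpace ℝ E]
  {H : Type*} [TopologicalSpace H] {I : ModelWithCorners ℝ E H} [I.Boundaryless]
  {N : Type*} [TopologicalSpace N] [ChartedSpace H N]

variable (I) in
/-- The coordinate expression of the vector field `X` in the preferred chart at `p`. -/
noncomputable def vectorInChart (p : N) (X : ∀ p : N, TangentSpace I p) : E → E :=
  VectorField.mpullback 𝓘(ℝ, E) I (extChartAt I p).symm X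

variable (I) in
/-- The frame of the tangent spaces given by the preferred chart at `p`, at the point with
coordinates `y`. -/
noncomputable def chartFrame (p : N) (y : E) : E →L[ℝ] E :=
  mfderiv 𝓘(ℝ, E) I (extChartAt I p).symm y

omit [I.Boundaryless] in
lemma vectorInChart_apply (p : N) (X : ∀ p : N, TangentSpace I p) (y : E) :
    vectorInChart I p X y = (chartFrame I p y).inverse (X ((extChartAt I p).symm y)) := rfl

/-- The tangent space at a point is identified with E by the preferred chart there, so the frame is
a Jacobian whose target chart varies with y. To differentiate it one must first fix the target
chart. -/
lemma chartFrame_eq_fderiv [IsManifold I 1 N] {p : N} {y : E}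
    (hy : y ∈ (extChartAt I p).target) :
    chartFrame I p y =
      fderiv ℝ (extChartAt I ((extChartAt I p).symm y) ∘ (extChartAt I p).symm) y := by
  have h := mdifferentiableWithinAt_extChartAt_symm hy
  rw [I.range_eq_univ, mdifferentiableWithinAt_univ] at h
  refine h.mfderiv.trans ?_
  rw [modelWithCornersSelf_coe, Set.range_id, fderivWithin_univ]
  rfl

lemma isInvertible_chartFrame [IsManifold I 1 N] {p : N} {y : E}
    (hy : y ∈ (extChartAt I p).target) : (chartFrame I p y).IsInvertible := by
  have := isInvertible_mfderivWithin_extChartAt_symm hy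
  rwa [I.range_eq_univ, mfderivWithin_univ] at this

lemma chartFrame_vectorInChart [IsManifold I 1 N] (X : ∀ p : N, TangentSpace I p) {p : N}
    {y : E} (hy : y ∈ (extChartAt I p).target) :
    chartFrame I p y (vectorInChart I p X y) = X ((extChartAt I p).symm y) :=
  (isInvertible_chartFrame hy).self_apply_inverse _

lemma chartFrame_self [IsManifold I 1 N] (p : N) :
    chartFrame I p (extChartAt I p p) = ContinuousLinearMap.id ℝ E := by
  have h := mfderivWithin_range_extChartAt_symm (I := I) (x := p)
  rw [I.range_eq_univ, mfderivWithin_univ] at h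
  exact h

lemma vectorInChart_self [IsManifold I 1 N] (X : ∀ p : N, TangentSpace I p) (p : N) :
    vectorInChart I p X (extChartAt I p p) = X p := by
  rw [vectorInChart_apply, chartFrame_self, ContinuousLinearMap.inverse_id, extChartAt_to_inv]
  rfl

/-- The preferred chart at p has the identity as its derivative at p, so pulling the coordinate
bracket back to p changes nothing. -/
lemma mlieBracket_eq_lieBracket_chart [IsManifold I 1 N] (X Y : ∀ p : N, TangentSpace I p) (p : N) :
    VectorField.mlieBracket I X Y p = (VectorField.lieBracket ℝ
      (vectorInChart I p X) (vectorInChart I p Y) (extChartAt I p p) : E) := by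
  have h : (mfderiv I 𝓘(ℝ, E) (extChartAt I p) p : E →L[ℝ] E) = ContinuousLinearMap.id ℝ E :=
    mfderiv_extChartAt_self
  have hX (X : ∀ p : N, TangentSpace I p) : (VectorField.mpullbackWithin 𝓘(ℝ, E) I
      (extChartAt I p).symm X (Set.range I) : E → E) = vectorInChart I p X := by
    rw [I.range_eq_univ]
    exact VectorField.mpullbackWithin_univ
  have hs : (extChartAt I p).symm ⁻¹' Set.univ ∩ Set.range I = Set.univ := by
    rw [I.range_eq_univ, Set.preimage_univ, Set.inter_univ]
  have key : ∀ (A : E →L[ℝ] E) (X' Y' : E → E) (s : Set E), A = ContinuousLinearMap.id ℝ E →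
      X' = vectorInChart I p X → Y' = vectorInChart I p Y → s = Set.univ →
      A.inverse (VectorField.lieBracketWithin ℝ X' Y' s (extChartAt I p p)) =
        VectorField.lieBracket ℝ (vectorInChart I p X) (vectorInChart I p Y)
          (extChartAt I p p) := by
    rintro _ _ _ _ rfl rfl rfl rfl
    rw [ContinuousLinearMap.inverse_id, VectorField.lieBracketWithin_univ]
    rfl
  exact key _ _ _ _ h (hX X) (hX Y) hs

lemma mvfderiv_eq_fderiv_chart {F : N → ℝ} {p : N}
    (hF : DifferentiableAt ℝ (F ∘ (extChartAt I p).symm) (extChartAt I p p)) (v : E) :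
    mvfderiv I F p v = fderiv ℝ (F ∘ (extChartAt I p).symm) (extChartAt I p p) v := by
  have hc : ContinuousAt F p := by
    have h1 : ContinuousAt ((F ∘ (extChartAt I p).symm) ∘ extChartAt I p) p :=
      ContinuousAt.comp hF.continuousAt (continuousAt_extChartAt p)
    refine h1.congr ?_
    filter_upwards [extChartAt_source_mem_nhds (I := I) p] with q hq
    exact congrArg F ((extChartAt I p).left_inv hq)
  have hd : MDifferentiableAt I 𝓘(ℝ, ℝ) F p := by
    rw [mdifferentiableAt_iff]
    refine ⟨hc, ?_⟩
    rw [I.range_eq_univ, differentiableWithinAt_univ]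
    exact hF
  have h : (mfderiv I 𝓘(ℝ, ℝ) F p : E →L[ℝ] ℝ) =
      fderiv ℝ (F ∘ (extChartAt I p).symm) (extChartAt I p p) := by
    refine hd.mfderiv.trans ?_
    rw [I.range_eq_univ, fderivWithin_univ]
    rfl
  exact congrArg (fun L : E →L[ℝ] ℝ => L v) h

lemma lieDerivTensor_eq_chart [IsManifold I 1 N] (X : ∀ p : N, TangentSpace I p)
    (T : ∀ p : N, TangentSpace I p →L[ℝ] TangentSpace I p →L[ℝ] ℝ)
    (Y Z : ∀ p : N, TangentSpace I p) (p : N)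
    (hF : DifferentiableAt ℝ (fun y => T ((extChartAt I p).symm y) (Y ((extChartAt I p).symm y))
      (Z ((extChartAt I p).symm y))) (extChartAt I p p)) :
    lieDerivTensor I X T Y Z p =
      fderiv ℝ (fun y => T ((extChartAt I p).symm y) (Y ((extChartAt I p).symm y))
        (Z ((extChartAt I p).symm y))) (extChartAt I p p) (X p : E)
      - T p (VectorField.lieBracket ℝ (vectorInChart I p X) (vectorInChart I p Y)
          (extChartAt I p p) : E) (Z p)
      - T p (Y p) (VectorField.lieBracket ℝ (vectorInChart I p X) (vectorInChart I p Z)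
          (extChartAt I p p) : E) := by
  rw [lieDerivTensor, mlieBracket_eq_lieBracket_chart, mlieBracket_eq_lieBracket_chart]
  congr 2
  exact mvfderiv_eq_fderiv_chart (F := fun q => T q (Y q) (Z q)) hF (X p)

lemma differentiableAt_vectorInChart [CompleteSpace E] [IsManifold I 2 N]
    {Y : ∀ p : N, TangentSpace I p} {p : N}
    (hY : MDifferentiableAt I I.tangent (fun q => (⟨q, Y q⟩ : TangentBundle I N)) p) :
    DifferentiableAt ℝ (vectorInChart I p Y) (extChartAt I p p) := by
  have h := MDifferentiableWithinAt.differentiableWithinAt_mpullbackWithin_vectorField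
    (s := Set.univ) (mdifferentiableWithinAt_univ.2 hY)
  rw [I.range_eq_univ, Set.preimage_univ, Set.inter_univ] at h
  have hX : (VectorField.mpullbackWithin 𝓘(ℝ, E) I (extChartAt I p).symm Y Set.univ : E → E) =
      vectorInChart I p Y := VectorField.mpullbackWithin_univ
  exact differentiableWithinAt_univ.1 (hX ▸ h)

end LieDerivInChart

/-! ### Coordinate changes, and the behaviour of frames and vector fields under them. -/

section Transition

set_option maxSynthPendingDepth 3

open Filter Topology

variable {E : Type*} [NormedAddCommGroup E] [NormedSpace ℝ E]
  {H : Type*} [TopologicalSpace H] (I : ModelWithCorners ℝ E H)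
  {N : Type*} [TopologicalSpace N] [ChartedSpace H N]

/-- The coordinate change from the preferred chart at `p` to the preferred chart at `q`. -/
noncomputable def transition (p q : N) : E → E := extChartAt I q ∘ (extChartAt I p).symm

variable {I}

lemma extChartAt_symm_transition {p q : N} {y : E}
    (hq : (extChartAt I p).symm y ∈ (extChartAt I q).source) :
    (extChartAt I q).symm (transition I p q y) = (extChartAt I p).symm y :=
  (extChartAt I q).left_inv hq

lemma transition_mem_target {p q : N} {y : E}
    (hq : (extChartAt I p).symm y ∈ (extChartAt I q).source) :
    transition I p q y ∈ (extChartAt I q).target :=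
  (extChartAt I q).map_source hq

variable [I.Boundaryless]

lemma eventually_mem_transition_source {p q : N} {y : E} (hy : y ∈ (extChartAt I p).target)
    (hq : (extChartAt I p).symm y ∈ (extChartAt I q).source) :
    ∀ᶠ y' in 𝓝 y, y' ∈ (extChartAt I p).target ∧
      (extChartAt I p).symm y' ∈ (extChartAt I q).source :=
  ((isOpen_extChartAt_target p).eventually_mem hy).and
    ((continuousAt_extChartAt_symm'' hy).eventually_mem
      ((isOpen_extChartAt_source q).mem_nhds hq))

lemma contDiffAt_transition {n : WithTop ℕ∞} [IsManifold I n N] {p q : N} {y : E}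
    (hy : y ∈ (extChartAt I p).target)
    (hq : (extChartAt I p).symm y ∈ (extChartAt I q).source) :
    ContDiffAt ℝ n (transition I p q) y := by
  have h := contDiffWithinAt_ext_coord_change (I := I) (n := n) q p (y := y) (by
    rw [PartialEquiv.trans_source]
    exact ⟨hy, hq⟩)
  rwa [I.range_eq_univ] at h

lemma fderiv_transition_comp [IsManifold I 1 N] {p m q : N} {y : E}
    (hy : y ∈ (extChartAt I p).target)
    (hm : (extChartAt I p).symm y ∈ (extChartAt I m).source)
    (hq : (extChartAt I p).symm y ∈ (extChartAt I q).source) (v : E) :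
    fderiv ℝ (transition I p q) y v =
      fderiv ℝ (transition I m q) (transition I p m y) (fderiv ℝ (transition I p m) y v) := by
  have h1 : DifferentiableAt ℝ (transition I m q) (transition I p m y) :=
    (contDiffAt_transition (n := 1) (transition_mem_target hm)
      (by rwa [extChartAt_symm_transition hm])).differentiableAt one_ne_zero
  have h2 : DifferentiableAt ℝ (transition I p m) y :=
    (contDiffAt_transition (n := 1) hy hm).differentiableAt one_ne_zero
  have h3 : transition I p q =ᶠ[𝓝 y] transition I m q ∘ transition I p m := by
    filter_upwards [eventually_mem_transition_source hy hm] with y' hy'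
    simp only [transition, Function.comp_apply, (extChartAt I m).left_inv hy'.2]
  rw [h3.fderiv_eq, fderiv_comp y h1 h2]
  rfl

lemma chartFrame_transition [IsManifold I 1 N] {p q : N} {y : E} (hy : y ∈ (extChartAt I p).target)
    (hq : (extChartAt I p).symm y ∈ (extChartAt I q).source) (v : E) :
    chartFrame I p y v = chartFrame I q (transition I p q y) (fderiv ℝ (transition I p q) y v) := by
  rw [chartFrame_eq_fderiv hy, chartFrame_eq_fderiv (transition_mem_target hq),
    extChartAt_symm_transition hq]
  exact fderiv_transition_comp hy hq (mem_extChartAt_source _) v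

lemma vectorInChart_transition [IsManifold I 1 N] (X : ∀ p : N, TangentSpace I p) {p q : N} {y : E}
    (hy : y ∈ (extChartAt I p).target)
    (hq : (extChartAt I p).symm y ∈ (extChartAt I q).source) :
    vectorInChart I q X (transition I p q y) =
      fderiv ℝ (transition I p q) y (vectorInChart I p X y) := by
  apply (isInvertible_chartFrame (transition_mem_target hq)).injective
  rw [← chartFrame_transition hy hq]
  -- Vectors at equal points are elements of the same space E, so an equality of base points can be
  -- used directly.
  have key : ∀ m m' : N, m = m' → (X m : E) = (X m' : E) := by rintro m _ rfl; rfl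
  exact (chartFrame_vectorInChart X (transition_mem_target hq)).trans
    ((key _ _ (extChartAt_symm_transition hq)).trans (chartFrame_vectorInChart X hy).symm)

lemma surjective_fderiv_transition [IsManifold I 1 N] {p q : N} {y : E}
    (hy : y ∈ (extChartAt I p).target)
    (hq : (extChartAt I p).symm y ∈ (extChartAt I q).source) :
    Function.Surjective (fderiv ℝ (transition I p q) y) := by
  intro v
  obtain ⟨w, hw⟩ := (isInvertible_chartFrame hy).surjective
    (chartFrame I q (transition I p q y) v)
  rw [chartFrame_transition hy hq] at hw
  exact ⟨w, (isInvertible_chartFrame (transition_mem_target hq)).injective hw⟩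

lemma contDiffAt_vectorInChart [CompleteSpace E] [IsManifold I ∞ N]
    {X : ∀ p : N, TangentSpace I p}
    (hX : ContMDiff I I.tangent ∞ (fun x => (⟨x, X x⟩ : TangentBundle I N))) {p : N} {y : E}
    (hy : y ∈ (extChartAt I p).target) : ContDiffAt ℝ ∞ (vectorInChart I p X) y := by
  have h1 : ContMDiffAt 𝓘(ℝ, E) I ∞ (extChartAt I p).symm y :=
    (contMDiffOn_extChartAt_symm p).contMDiffAt ((isOpen_extChartAt_target p).mem_nhds hy)
  have h2 := isInvertible_mfderivWithin_extChartAt_symm hy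
  rw [I.range_eq_univ, mfderivWithin_univ] at h2
  exact contMDiffAt_vectorSpace_iff_contDiffAt.1
    (ContMDiffAt.mpullback_vectorField_preimage (hX _) h1 h2 le_rfl)

/-- The coordinate field with constant components v is the tangent map of the inverse chart applied
to a constant section, hence smooth. It is used for the smoothness of the metric coefficients. -/
lemma contMDiffAt_chartFrame [IsManifold I ∞ N] {p : N} {y : E}
    (hy : y ∈ (extChartAt I p).target) (v : E) :
    ContMDiffAt 𝓘(ℝ, E) I.tangent ∞ (fun y' => (⟨(extChartAt I p).symm y',
      (chartFrame I p y' v : E)⟩ : TangentBundle I N)) y := by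
  have ho := isOpen_extChartAt_target (I := I) p
  have h1 : ContMDiffOn 𝓘(ℝ, E) I ∞ (extChartAt I p).symm (extChartAt I p).target :=
    contMDiffOn_extChartAt_symm p
  have h2 := h1.contMDiffOn_tangentMapWithin (m := ∞) le_rfl ho.uniqueMDiffOn
  have h0 : ContDiff ℝ ∞ (fun _ : E => v) := contDiff_const
  have h3 : ContMDiff 𝓘(ℝ, E) 𝓘(ℝ, E).tangent ∞
      (fun y' : E => (⟨y', v⟩ : TangentBundle 𝓘(ℝ, E) E)) :=
    contMDiff_vectorSpace_iff_contDiff.2 h0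
  have h4 := (h2.comp h3.contMDiffOn (s := (extChartAt I p).target) fun y' hy' => hy').contMDiffAt
    (ho.mem_nhds hy)
  refine h4.congr_of_eventuallyEq ?_
  filter_upwards [ho.mem_nhds hy] with y' hy'
  simp only [Function.comp_apply, tangentMapWithin, mfderivWithin_of_isOpen ho hy']
  rfl

end Transition

/-! ### The metric, its Christoffel symbols and the conformal equation in charts of M. -/

section Metric

set_option maxSynthPendingDepth 3

open Filter Topology

variable {E : Type*} [NormedAddCommGroup E] [NormedSpace ℝ E]
  {M : Type*} [TopologicalSpace M] [ChartedSpace E M] [IsManifold 𝓘(ℝ, E) ∞ M]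
  (g : Bundle.ContMDiffRiemannianMetric 𝓘(ℝ, E) ∞ E (TangentSpace 𝓘(ℝ, E) : M → Type _))

lemma metricInChart_apply (x : M) (y a b : E) :
    metricInChart g x y a b = g.inner ((extChartAt 𝓘(ℝ, E) x).symm y)
      (chartFrame 𝓘(ℝ, E) x y a : E) (chartFrame 𝓘(ℝ, E) x y b : E) := rfl

lemma metricInChart_self (x : M) (a b : E) :
    metricInChart g x (extChartAt 𝓘(ℝ, E) x x) a b = g.inner x a b := by
  rw [metricInChart_apply, chartFrame_self, extChartAt_to_inv]
  rfl

lemma metricInChart_comm (x : M) (y a b : E) :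
    metricInChart g x y a b = metricInChart g x y b a := by
  rw [metricInChart_apply, metricInChart_apply]
  exact g.symm _ _ _

lemma metricInChart_nonneg (x : M) (y a : E) : 0 ≤ metricInChart g x y a a := by
  by_cases h : chartFrame 𝓘(ℝ, E) x y a = 0
  · rw [metricInChart_apply, h]
    exact (map_zero _).ge
  · exact (g.pos _ _ h).le

/-- Positive definiteness makes the map E → E* injective, and the dimensions agree. -/
lemma isInvertible_metricInChart [FiniteDimensional ℝ E] {x : M} {y : E}
    (hy : y ∈ (extChartAt 𝓘(ℝ, E) x).target) : (metricInChart g x y).IsInvertible := by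
  have hinj : Function.Injective (metricInChart g x y) := by
    rw [injective_iff_map_eq_zero]
    intro a ha
    by_contra h
    have h1 : chartFrame 𝓘(ℝ, E) x y a ≠ 0 := fun h0 =>
      h ((isInvertible_chartFrame hy).injective (h0.trans (map_zero _).symm))
    have h2 : 0 < metricInChart g x y a a := g.pos _ _ h1
    rw [ha] at h2
    exact h2.ne' rfl
  have hdim : Module.finrank ℝ E = Module.finrank ℝ (E →L[ℝ] ℝ) := by
    rw [← (LinearMap.toContinuousLinearMap (𝕜 := ℝ) (E := E) (F' := ℝ)).finrank_eq]
    exact Subspace.dual_finrank_eq.symm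
  exact ⟨(LinearEquiv.ofInjectiveOfFinrankEq (metricInChart g x y).toLinearMap hinj
    hdim).toContinuousLinearEquiv, by ext; rfl⟩

lemma contDiffAt_metricInChart [FiniteDimensional ℝ E] {x : M} {y : E}
    (hy : y ∈ (extChartAt 𝓘(ℝ, E) x).target) : ContDiffAt ℝ ∞ (metricInChart g x) y := by
  have ho := isOpen_extChartAt_target (I := 𝓘(ℝ, E)) x
  refine ContDiffOn.contDiffAt ?_ (ho.mem_nhds hy)
  refine contDiffOn_clm_apply.2 fun a => contDiffOn_clm_apply.2 fun b y' hy' => ?_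
  have h1 : ContMDiffAt 𝓘(ℝ, E) 𝓘(ℝ, E) ∞ (extChartAt 𝓘(ℝ, E) x).symm y' :=
    (contMDiffOn_extChartAt_symm x).contMDiffAt (ho.mem_nhds hy')
  have h2 := ContMDiffAt.clm_bundle_apply₂ (F₁ := E) (F₂ := E) (F₃ := ℝ)
    (E₃ := fun _ : M => ℝ) (g.contMDiff.contMDiffAt.comp y' h1)
    (contMDiffAt_chartFrame hy' a) (contMDiffAt_chartFrame hy' b)
  have h3 := (Bundle.contMDiffAt_totalSpace.1 h2).2
  exact (contMDiffAt_iff_contDiffAt.1 h3).contDiffWithinAt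

lemma metricInChart_transition {x m : M} {y : E} (hy : y ∈ (extChartAt 𝓘(ℝ, E) x).target)
    (hm : (extChartAt 𝓘(ℝ, E) x).symm y ∈ (extChartAt 𝓘(ℝ, E) m).source) (a b : E) :
    metricInChart g x y a b = metricInChart g m (transition 𝓘(ℝ, E) x m y)
      (fderiv ℝ (transition 𝓘(ℝ, E) x m) y a) (fderiv ℝ (transition 𝓘(ℝ, E) x m) y b) := by
  have key : ∀ q q' : M, q = q' → ∀ a b : E, g.inner q a b = g.inner q' a b := by
    rintro q _ rfl a b; rfl
  rw [metricInChart_apply, metricInChart_apply, ← chartFrame_transition hy hm,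
    ← chartFrame_transition hy hm]
  exact key _ _ (extChartAt_symm_transition hm).symm _ _

lemma christoffel_eq_localChristoffel (x : M) (v w : E) :
    christoffel g x v w = localChristoffel (metricInChart g x) (extChartAt 𝓘(ℝ, E) x x) v w := by
  rw [localChristoffel_apply]
  refine congrArg (metricInChart g x (extChartAt 𝓘(ℝ, E) x x)).inverse ?_
  ext z
  rw [christoffelFirstCLM_apply]
  rfl

/-- The transformation law from the Christoffel symbols in the preferred chart at `x` to those in
the preferred chart at the point with coordinates `y`. -/
lemma christoffel_transition [FiniteDimensional ℝ E] {x m : M} {y : E}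
    (hy : y ∈ (extChartAt 𝓘(ℝ, E) x).target) (hm : (extChartAt 𝓘(ℝ, E) x).symm y = m) (v w : E) :
    fderiv ℝ (transition 𝓘(ℝ, E) x m) y (localChristoffel (metricInChart g x) y v w) =
      fderiv ℝ (fderiv ℝ (transition 𝓘(ℝ, E) x m)) y v w +
      christoffel g m (fderiv ℝ (transition 𝓘(ℝ, E) x m) y v)
        (fderiv ℝ (transition 𝓘(ℝ, E) x m) y w) := by
  have hms : (extChartAt 𝓘(ℝ, E) x).symm y ∈ (extChartAt 𝓘(ℝ, E) m).source :=
    hm ▸ mem_extChartAt_source _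
  have hφ : transition 𝓘(ℝ, E) x m y = extChartAt 𝓘(ℝ, E) m m := by
    rw [← hm]; rfl
  have ht := transition_mem_target hms
  rw [christoffel_eq_localChristoffel, ← hφ]
  refine localChristoffel_pullback (contDiffAt_transition hy hms)
    ((contDiffAt_metricInChart g hy).differentiableAt (by simp))
    ((contDiffAt_metricInChart g ht).differentiableAt (by simp)) ?_
    (isInvertible_metricInChart g hy) (isInvertible_metricInChart g ht)
    (surjective_fderiv_transition hy hms) (metricInChart_comm g _ _) v w
  filter_upwards [eventually_mem_transition_source hy hms] with y' hy' a b
  exact metricInChart_transition g hy'.1 hy'.2 a b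

/-- The coordinate expression of `L_X g = f g` at the centre of a chart. -/
lemma localLieDeriv_metricInChart_self [FiniteDimensional ℝ E]
    {X : ∀ x : M, TangentSpace 𝓘(ℝ, E) x}
    {f : M → ℝ} (hconf : LieDerivTensorEq 𝓘(ℝ, E) X g.inner (fun x => f x • g.inner x))
    (m : M) (a b : E) :
    localLieDeriv (vectorInChart 𝓘(ℝ, E) m X) (metricInChart g m) (extChartAt 𝓘(ℝ, E) m m) a b =
      f m * metricInChart g m (extChartAt 𝓘(ℝ, E) m m) a b := by
  set y := extChartAt 𝓘(ℝ, E) m m with hy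
  have hyt : y ∈ (extChartAt 𝓘(ℝ, E) m).target := mem_extChartAt_target m
  -- The hypothesis concerns vector fields, so a and b are extended to fields smooth at m; the
  -- result depends only on their values there.
  obtain ⟨Y, hY, hYm⟩ : ∃ Y : ∀ x : M, TangentSpace 𝓘(ℝ, E) x, ContMDiffAt 𝓘(ℝ, E)
      𝓘(ℝ, E).tangent ∞ (fun q => (⟨q, Y q⟩ : TangentBundle 𝓘(ℝ, E) M)) m ∧ (Y m : E) = a :=
    ⟨FiberBundle.extend E (x := m) (E := TangentSpace 𝓘(ℝ, E)) a,
      FiberBundle.contMDiffAt_extend _ _ _, FiberBundle.extend_apply_self _ _⟩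
  obtain ⟨Z, hZ, hZm⟩ : ∃ Z : ∀ x : M, TangentSpace 𝓘(ℝ, E) x, ContMDiffAt 𝓘(ℝ, E)
      𝓘(ℝ, E).tangent ∞ (fun q => (⟨q, Z q⟩ : TangentBundle 𝓘(ℝ, E) M)) m ∧ (Z m : E) = b :=
    ⟨FiberBundle.extend E (x := m) (E := TangentSpace 𝓘(ℝ, E)) b,
      FiberBundle.contMDiffAt_extend _ _ _, FiberBundle.extend_apply_self _ _⟩
  have hγ := ((contDiffAt_metricInChart g hyt).differentiableAt (by simp)).hasFDerivAt
  have hY' := (differentiableAt_vectorInChart (hY.mdifferentiableAt (by simp))).hasFDerivAt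
  have hZ' := (differentiableAt_vectorInChart (hZ.mdifferentiableAt (by simp))).hasFDerivAt
  have hF := ((hγ.clm_apply hY').clm_apply hZ').congr_of_eventuallyEq
    (f₁ := fun y => g.inner ((extChartAt 𝓘(ℝ, E) m).symm y)
      (Y ((extChartAt 𝓘(ℝ, E) m).symm y)) (Z ((extChartAt 𝓘(ℝ, E) m).symm y))) <| by
    filter_upwards [(isOpen_extChartAt_target m).mem_nhds hyt] with y' hy'
    rw [metricInChart_apply, chartFrame_vectorInChart Y hy', chartFrame_vectorInChart Z hy']
  have h1 := hconf m Y Z hY hZ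
  rw [lieDerivTensor_eq_chart X g.inner Y Z m hF.differentiableAt] at h1
  have e (a b : E) : metricInChart g m y a b = g.inner m a b := metricInChart_self g m a b
  have h2 : ∀ u v w : E, X m = u → Y m = v → Z m = w →
      fderiv ℝ (fun y => g.inner ((extChartAt 𝓘(ℝ, E) m).symm y)
      (Y ((extChartAt 𝓘(ℝ, E) m).symm y)) (Z ((extChartAt 𝓘(ℝ, E) m).symm y))) y u
      - metricInChart g m y (VectorField.lieBracket ℝ (vectorInChart 𝓘(ℝ, E) m X)
        (vectorInChart 𝓘(ℝ, E) m Y) y) w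
      - metricInChart g m y v (VectorField.lieBracket ℝ (vectorInChart 𝓘(ℝ, E) m X)
        (vectorInChart 𝓘(ℝ, E) m Z) y) = f m * metricInChart g m y v w := by
    intro u v w hu hv hw
    rw [e, e, e]
    subst hu hv hw
    exact h1
  have h3 := h2 _ _ _ (vectorInChart_self X m).symm hYm hZm
  have hYy : vectorInChart 𝓘(ℝ, E) m Y y = a := (vectorInChart_self Y m).trans hYm
  have hZy : vectorInChart 𝓘(ℝ, E) m Z y = b := (vectorInChart_self Z m).trans hZm
  rw [hF.fderiv, hYy, hZy] at h3
  rw [← h3]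
  -- The derivatives of Y and Z from the product rule cancel against those in the brackets.
  simp only [localLieDeriv, VectorField.lieBracket, add_apply,
    ContinuousLinearMap.comp_apply, ContinuousLinearMap.flip_apply, map_sub, sub_apply, hYy, hZy,
    ← hy]
  ring

/-- The coordinate expression of `L_X g = f g`. -/
lemma localLieDeriv_metricInChart [FiniteDimensional ℝ E]
    {X : ∀ x : M, TangentSpace 𝓘(ℝ, E) x}
    (hX : ContMDiff 𝓘(ℝ, E) 𝓘(ℝ, E).tangent ∞
      (fun x => (⟨x, X x⟩ : TangentBundle 𝓘(ℝ, E) M)))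
    {f : M → ℝ} (hconf : LieDerivTensorEq 𝓘(ℝ, E) X g.inner (fun x => f x • g.inner x))
    {x : M} {y : E} (hy : y ∈ (extChartAt 𝓘(ℝ, E) x).target) (a b : E) :
    localLieDeriv (vectorInChart 𝓘(ℝ, E) x X) (metricInChart g x) y a b =
      f ((extChartAt 𝓘(ℝ, E) x).symm y) * metricInChart g x y a b := by
  set m := (extChartAt 𝓘(ℝ, E) x).symm y with hm
  have hms : (extChartAt 𝓘(ℝ, E) x).symm y ∈ (extChartAt 𝓘(ℝ, E) m).source :=
    mem_extChartAt_source _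
  have ht := transition_mem_target hms
  -- Pass to the preferred chart at the point m with coordinates y, where the equation is known at
  -- the centre, and return by naturality.
  rw [localLieDeriv_pullback (φ := transition 𝓘(ℝ, E) x m) (contDiffAt_transition hy hms)
    ((contDiffAt_metricInChart g hy).differentiableAt (by simp))
    ((contDiffAt_metricInChart g ht).differentiableAt (by simp)) ?_
    ((contDiffAt_vectorInChart hX hy).differentiableAt (by simp))
    ((contDiffAt_vectorInChart hX ht).differentiableAt (by simp)) ?_,
    metricInChart_transition g hy hms]
  · exact localLieDeriv_metricInChart_self g hconf m _ _
  · filter_upwards [eventually_mem_transition_source hy hms] with y' hy' a b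
    exact metricInChart_transition g hy'.1 hy'.2 a b
  · filter_upwards [eventually_mem_transition_source hy hms] with y' hy'
    exact vectorInChart_transition X hy'.1 hy'.2

end Metric

/-! ### The induced charts of the tangent bundle -/

section TangentBundleChart

set_option maxSynthPendingDepth 3

open Filter Topology

variable {E : Type*} [NormedAddCommGroup E] [NormedSpace ℝ E]
  {M : Type*} [TopologicalSpace M] [ChartedSpace E M] [IsManifold 𝓘(ℝ, E) ∞ M]

lemma extChartAt_tangent_target (p : TangentBundle 𝓘(ℝ, E) M) :
    (extChartAt 𝓘(ℝ, E).tangent p).target =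
      (extChartAt 𝓘(ℝ, E) p.proj).target ×ˢ (Set.univ : Set E) := by
  refine (FiberBundle.extChartAt_target (IB := 𝓘(ℝ, E)) p).trans ?_
  congr 1
  refine Set.inter_eq_left.2 fun y hy => ?_
  have := (extChartAt 𝓘(ℝ, E) p.proj).map_target hy
  rwa [extChartAt_source] at this

lemma extChartAt_tangent_symm_apply (p : TangentBundle 𝓘(ℝ, E) M) {z : E × E}
    (hz : z.1 ∈ (extChartAt 𝓘(ℝ, E) p.proj).target) :
    (extChartAt 𝓘(ℝ, E).tangent p).symm z =
      ⟨(extChartAt 𝓘(ℝ, E) p.proj).symm z.1, (chartFrame 𝓘(ℝ, E) p.proj z.1 z.2 : E)⟩ := by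
  have h : ∀ q : M, (q = (extChartAt 𝓘(ℝ, E) p.proj).symm z.1) →
      (tangentCoordChange 𝓘(ℝ, E) p.proj q q : E →L[ℝ] E) = chartFrame 𝓘(ℝ, E) p.proj z.1 := by
    rintro q rfl
    rw [tangentCoordChange_def, chartFrame_eq_fderiv hz, (extChartAt 𝓘(ℝ, E) p.proj).right_inv hz,
      modelWithCornersSelf_coe, Set.range_id, fderivWithin_univ]
  rw [← h _ rfl]
  rfl

lemma extChartAt_tangent_apply (q r : TangentBundle 𝓘(ℝ, E) M) :
    extChartAt 𝓘(ℝ, E).tangent q r =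
      (extChartAt 𝓘(ℝ, E) q.proj r.proj,
        fderiv ℝ (transition 𝓘(ℝ, E) r.proj q.proj) (extChartAt 𝓘(ℝ, E) r.proj r.proj) r.snd) := by
  rw [← fderivWithin_univ, ← Set.range_id]
  rfl

lemma extChartAt_tangent_self (p : TangentBundle 𝓘(ℝ, E) M) :
    extChartAt 𝓘(ℝ, E).tangent p p = (extChartAt 𝓘(ℝ, E) p.proj p.proj, (p.snd : E)) := by
  rw [extChartAt_tangent_apply]
  have h := chartFrame_eq_fderiv (mem_extChartAt_target (I := 𝓘(ℝ, E)) p.proj)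
  rw [chartFrame_self, extChartAt_to_inv] at h
  exact congrArg (fun A : E →L[ℝ] E => (extChartAt 𝓘(ℝ, E) p.proj p.proj, A p.snd)) h.symm

/-- Coordinate changes of the tangent bundle are tangent maps of coordinate changes. -/
lemma transition_tangent (p q : TangentBundle 𝓘(ℝ, E) M) {z : E × E}
    (hz : z.1 ∈ (extChartAt 𝓘(ℝ, E) p.proj).target)
    (hq : (extChartAt 𝓘(ℝ, E) p.proj).symm z.1 ∈ (extChartAt 𝓘(ℝ, E) q.proj).source) :
    transition 𝓘(ℝ, E).tangent p q z =
      localCompleteLift (transition 𝓘(ℝ, E) p.proj q.proj) z := by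
  rw [transition, Function.comp_apply, extChartAt_tangent_symm_apply p hz,
    extChartAt_tangent_apply, localCompleteLift, fderiv_transition_comp hz
      (mem_extChartAt_source ((extChartAt 𝓘(ℝ, E) p.proj).symm z.1)) hq, chartFrame_eq_fderiv hz]
  rfl

/-- The frame is the Jacobian of the tangent map of a coordinate change of M. Its second-derivative
term is the one that the transformation law of Γ compensates. -/
lemma chartFrame_tangent (p : TangentBundle 𝓘(ℝ, E) M) {z : E × E} {m : M}
    (hz : z.1 ∈ (extChartAt 𝓘(ℝ, E) p.proj).target)
    (hm : (extChartAt 𝓘(ℝ, E) p.proj).symm z.1 = m) (ζ : E × E) :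
    chartFrame 𝓘(ℝ, E).tangent p z ζ =
      (fderiv ℝ (transition 𝓘(ℝ, E) p.proj m) z.1 ζ.1,
        fderiv ℝ (fderiv ℝ (transition 𝓘(ℝ, E) p.proj m)) z.1 ζ.1 z.2
          + fderiv ℝ (transition 𝓘(ℝ, E) p.proj m) z.1 ζ.2) := by
  have hms : (extChartAt 𝓘(ℝ, E) p.proj).symm z.1 ∈ (extChartAt 𝓘(ℝ, E) m).source :=
    hm ▸ mem_extChartAt_source _
  have hzt : z ∈ (extChartAt 𝓘(ℝ, E).tangent p).target := by
    rw [extChartAt_tangent_target]; exact ⟨hz, trivial⟩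
  rw [← fderiv_localCompleteLift (contDiffAt_transition hz hms), chartFrame_eq_fderiv hzt]
  have hpr : ((extChartAt 𝓘(ℝ, E).tangent p).symm z).proj = m := by
    rw [extChartAt_tangent_symm_apply p hz]; exact hm
  refine congrArg (fun A : E × E →L[ℝ] E × E => A ζ) (EventuallyEq.fderiv_eq ?_)
  filter_upwards [continuousAt_fst.eventually (eventually_mem_transition_source hz hms)]
    with z' hz'
  exact (transition_tangent p _ hz'.1 (by rw [hpr]; exact hz'.2)).trans (by rw [hpr])

/-! ### Natural metrics and complete lifts in the induced charts -/

variable {p : TangentBundle 𝓘(ℝ, E) M} {z : E × E}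

/-- Complete lifts have the same coordinate expression in all induced charts. -/
lemma chartFrame_tangent_localCompleteLift [CompleteSpace E] {X : ∀ x : M, TangentSpace 𝓘(ℝ, E) x}
    (hX : ContMDiff 𝓘(ℝ, E) 𝓘(ℝ, E).tangent ∞
      (fun x => (⟨x, X x⟩ : TangentBundle 𝓘(ℝ, E) M)))
    (hz : z.1 ∈ (extChartAt 𝓘(ℝ, E) p.proj).target) :
    chartFrame 𝓘(ℝ, E).tangent p z (localCompleteLift (vectorInChart 𝓘(ℝ, E) p.proj X) z) =
      completeLift X ((extChartAt 𝓘(ℝ, E).tangent p).symm z) := by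
  set m := (extChartAt 𝓘(ℝ, E) p.proj).symm z.1 with hm
  have hms : (extChartAt 𝓘(ℝ, E) p.proj).symm z.1 ∈ (extChartAt 𝓘(ℝ, E) m).source :=
    mem_extChartAt_source _
  have h1 : completeLift X ((extChartAt 𝓘(ℝ, E).tangent p).symm z) =
      ((X m : E), fderiv ℝ (vectorInChart 𝓘(ℝ, E) m X) (transition 𝓘(ℝ, E) p.proj m z.1)
        (chartFrame 𝓘(ℝ, E) p.proj z.1 z.2)) := by
    rw [extChartAt_tangent_symm_apply p hz]
    rfl
  rw [h1, chartFrame_tangent p hz hm.symm, chartFrame_eq_fderiv hz]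
  refine Prod.ext ?_ ?_
  · exact (vectorInChart_transition X hz hms).symm.trans (vectorInChart_self X m)
  · change _ = fderiv ℝ (vectorInChart 𝓘(ℝ, E) m X) (transition 𝓘(ℝ, E) p.proj m z.1)
      (fderiv ℝ (transition 𝓘(ℝ, E) p.proj m) z.1 z.2)
    rw [fderiv_pushforward (contDiffAt_transition hz hms)
      ((contDiffAt_vectorInChart hX hz).differentiableAt (by simp))
      ((contDiffAt_vectorInChart hX (transition_mem_target hms)).differentiableAt (by simp))
      ((eventually_mem_transition_source hz hms).mono fun y' hy' =>
        vectorInChart_transition X hy'.1 hy'.2),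
      second_fderiv_symm (contDiffAt_transition hz hms) z.2]
    rfl

lemma vectorInChart_completeLift [CompleteSpace E] {X : ∀ x : M, TangentSpace 𝓘(ℝ, E) x}
    (hX : ContMDiff 𝓘(ℝ, E) 𝓘(ℝ, E).tangent ∞
      (fun x => (⟨x, X x⟩ : TangentBundle 𝓘(ℝ, E) M)))
    (hz : z.1 ∈ (extChartAt 𝓘(ℝ, E) p.proj).target) :
    vectorInChart 𝓘(ℝ, E).tangent p (completeLift X) z =
      localCompleteLift (vectorInChart 𝓘(ℝ, E) p.proj X) z := by
  have hzt : z ∈ (extChartAt 𝓘(ℝ, E).tangent p).target := by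
    rw [extChartAt_tangent_target]; exact ⟨hz, trivial⟩
  apply (isInvertible_chartFrame hzt).injective
  rw [chartFrame_tangent_localCompleteLift hX hz]
  exact chartFrame_vectorInChart _ hzt

variable {g : Bundle.ContMDiffRiemannianMetric 𝓘(ℝ, E) ∞ E (TangentSpace 𝓘(ℝ, E) : M → Type _)}
  {G : ∀ p : TangentBundle 𝓘(ℝ, E) M, TangentSpace 𝓘(ℝ, E).tangent p →L[ℝ]
      TangentSpace 𝓘(ℝ, E).tangent p →L[ℝ] ℝ}

/-- A natural metric in terms of the components of tangent vectors. -/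
lemma IsGNatural.exists_eq_naturalForm (hG : IsGNatural g G) :
    ∃ a₁ a₂ a₃ b₁ b₂ b₃ : ℝ → ℝ,
      (DifferentiableOn ℝ a₁ (Set.Ici 0) ∧ DifferentiableOn ℝ a₂ (Set.Ici 0) ∧
        DifferentiableOn ℝ a₃ (Set.Ici 0) ∧ DifferentiableOn ℝ b₁ (Set.Ici 0) ∧
        DifferentiableOn ℝ b₂ (Set.Ici 0) ∧ DifferentiableOn ℝ b₃ (Set.Ici 0)) ∧
      ∀ (m : M) (u : E) (ζ ζ' : E × E),
        G ⟨m, u⟩ ζ ζ' = naturalForm a₁ a₂ a₃ b₁ b₂ b₃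
          (metricInChart g m (extChartAt 𝓘(ℝ, E) m m))
          (localChristoffel (metricInChart g m) (extChartAt 𝓘(ℝ, E) m m)) u ζ ζ' := by
  obtain ⟨a₁, a₂, a₃, b₁, b₂, b₃, ⟨ha₁, ha₂, ha₃, hb₁, hb₂, hb₃⟩, hG⟩ := hG
  refine ⟨a₁, a₂, a₃, b₁, b₂, b₃, ⟨ha₁.differentiableOn (by simp), ha₂.differentiableOn (by simp),
    ha₃.differentiableOn (by simp), hb₁.differentiableOn (by simp), hb₂.differentiableOn (by simp),
    hb₃.differentiableOn (by simp)⟩, fun m u ζ ζ' => ?_⟩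
  let K : E × E → E :=
    connector (localChristoffel (metricInChart g m) (extChartAt 𝓘(ℝ, E) m m)) u
  let h : E → E × E := horizontalLift g (⟨m, u⟩ : TangentBundle 𝓘(ℝ, E) M)
  let v : E → E × E := verticalLift (⟨m, u⟩ : TangentBundle 𝓘(ℝ, E) M)
  -- A tangent vector of TM is the horizontal lift of its base component plus the vertical lift of
  -- its connector.
  have hζ (ζ : E × E) : ζ = h ζ.1 + v (K ζ) := by
    refine Prod.ext (add_zero ζ.1).symm ?_
    change ζ.2 = -christoffel g m u ζ.1 + (ζ.2 + localChristoffel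
        (metricInChart g m) (extChartAt 𝓘(ℝ, E) m m) u ζ.1)
    rw [christoffel_eq_localChristoffel]
    abel
  have hadd (A : E × E →L[ℝ] E × E →L[ℝ] ℝ) (a b c d : E × E) :
      A (a + b) (c + d) = A a c + A a d + A b c + A b d := by
    simp only [map_add, add_apply]; ring
  have h1 : G ⟨m, u⟩ ζ ζ' = G ⟨m, u⟩ (h ζ.1 + v (K ζ)) (h ζ'.1 + v (K ζ')) :=
    congrArg₂ (fun a b : E × E => G ⟨m, u⟩ a b) (hζ ζ) (hζ ζ')
  refine (h1.trans (hadd (G ⟨m, u⟩) _ _ _ _)).trans ?_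
  simp only [naturalForm, metricInChart_self]
  exact congrArg₂ (· + ·) (congrArg₂ (· + ·) (congrArg₂ (· + ·) (hG m u ζ.1 ζ'.1).1
    (hG m u ζ.1 (K ζ')).2.1) (hG m u (K ζ) ζ'.1).2.2.1) (hG m u (K ζ) (K ζ')).2.2.2

/-- A natural metric in an induced chart. -/
lemma naturalForm_chart [FiniteDimensional ℝ E] {a₁ a₂ a₃ b₁ b₂ b₃ : ℝ → ℝ}
    (hG : ∀ (m : M) (u : E) (ζ ζ' : E × E),
        G ⟨m, u⟩ ζ ζ' = naturalForm a₁ a₂ a₃ b₁ b₂ b₃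
          (metricInChart g m (extChartAt 𝓘(ℝ, E) m m))
          (localChristoffel (metricInChart g m) (extChartAt 𝓘(ℝ, E) m m)) u ζ ζ')
    (hz : z.1 ∈ (extChartAt 𝓘(ℝ, E) p.proj).target) (ζ ζ' : E × E) :
    G ((extChartAt 𝓘(ℝ, E).tangent p).symm z) (chartFrame 𝓘(ℝ, E).tangent p z ζ : E × E)
      (chartFrame 𝓘(ℝ, E).tangent p z ζ' : E × E) =
    naturalForm a₁ a₂ a₃ b₁ b₂ b₃ (metricInChart g p.proj z.1)
      (localChristoffel (metricInChart g p.proj) z.1) z.2 ζ ζ' := by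
  set m := (extChartAt 𝓘(ℝ, E) p.proj).symm z.1 with hm
  have hms : (extChartAt 𝓘(ℝ, E) p.proj).symm z.1 ∈ (extChartAt 𝓘(ℝ, E) m).source :=
    mem_extChartAt_source _
  have hφ : extChartAt 𝓘(ℝ, E) m m = transition 𝓘(ℝ, E) p.proj m z.1 := rfl
  have key : ∀ q : TangentBundle 𝓘(ℝ, E) M, q = (extChartAt 𝓘(ℝ, E).tangent p).symm z →
      ∀ ζ ζ' : E × E, G ((extChartAt 𝓘(ℝ, E).tangent p).symm z) ζ ζ' = G q ζ ζ' := by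
    rintro q rfl ζ ζ'; rfl
  -- The connector is tensorial: the D²φ term of the frame cancels the inhomogeneous term in the
  -- transformation law of Γ.
  have hK (ζ : E × E) : connector (localChristoffel (metricInChart g m) (extChartAt 𝓘(ℝ, E) m m))
      (chartFrame 𝓘(ℝ, E) p.proj z.1 z.2) (chartFrame 𝓘(ℝ, E).tangent p z ζ) =
      fderiv ℝ (transition 𝓘(ℝ, E) p.proj m) z.1
        (connector (localChristoffel (metricInChart g p.proj) z.1) z.2 ζ) := by
    rw [chartFrame_tangent p hz hm.symm, connector, connector, map_add,
      christoffel_transition g hz hm.symm, christoffel_eq_localChristoffel,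
      second_fderiv_symm (contDiffAt_transition hz hms) z.2, chartFrame_eq_fderiv hz]
    change _ + _ + localChristoffel _ _ (fderiv ℝ (transition 𝓘(ℝ, E) p.proj m) z.1 z.2)
      (fderiv ℝ (transition 𝓘(ℝ, E) p.proj m) z.1 ζ.1) = _
    abel
  have hF : chartFrame 𝓘(ℝ, E) p.proj z.1 = fderiv ℝ (transition 𝓘(ℝ, E) p.proj m) z.1 :=
    chartFrame_eq_fderiv hz
  have h1 (ζ : E × E) : (chartFrame 𝓘(ℝ, E).tangent p z ζ).1 =
      fderiv ℝ (transition 𝓘(ℝ, E) p.proj m) z.1 ζ.1 := by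
    rw [chartFrame_tangent p hz hm.symm]
  rw [key _ (extChartAt_tangent_symm_apply p hz).symm, hG]
  simp only [naturalForm, ← hm, hK, h1]
  simp only [hφ, hF, ← metricInChart_transition g hz hms]

end TangentBundleChart

/-! ### The Lie derivative of G along the complete lift, and the theorem. -/

section Killing

set_option maxSynthPendingDepth 3

open Filter Topology

variable {E : Type*} [NormedAddCommGroup E] [NormedSpace ℝ E] [FiniteDimensional ℝ E]
  {M : Type*} [TopologicalSpace M] [ChartedSpace E M] [IsManifold 𝓘(ℝ, E) ∞ M]
  {g : Bundle.ContMDiffRiemannianMetric 𝓘(ℝ, E) ∞ E (TangentSpace 𝓘(ℝ, E) : M → Type _)}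
  {G : ∀ p : TangentBundle 𝓘(ℝ, E) M, TangentSpace 𝓘(ℝ, E).tangent p →L[ℝ]
      TangentSpace 𝓘(ℝ, E).tangent p →L[ℝ] ℝ}
  {X : ∀ x : M, TangentSpace 𝓘(ℝ, E) x} {f : M → ℝ}

/-- If `L_X g = f g`, then `L_{X^C} G = f G` at the points of the zero section, and everywhere if
`f = 0`. -/
lemma lieDerivTensor_completeLift
    (hX : ContMDiff 𝓘(ℝ, E) 𝓘(ℝ, E).tangent ∞
      (fun x => (⟨x, X x⟩ : TangentBundle 𝓘(ℝ, E) M)))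
    (hconf : LieDerivTensorEq 𝓘(ℝ, E) X g.inner (fun x => f x • g.inner x))
    (hG : IsGNatural g G) {p : TangentBundle 𝓘(ℝ, E) M}
    (hp : (p.snd : E) = 0 ∨ ∀ x, f x = 0)
    {Y Z : ∀ q : TangentBundle 𝓘(ℝ, E) M, TangentSpace 𝓘(ℝ, E).tangent q}
    (hY : ContMDiffAt 𝓘(ℝ, E).tangent 𝓘(ℝ, E).tangent.tangent ∞
      (fun q => (⟨q, Y q⟩ : TangentBundle 𝓘(ℝ, E).tangent (TangentBundle 𝓘(ℝ, E) M))) p)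
    (hZ : ContMDiffAt 𝓘(ℝ, E).tangent 𝓘(ℝ, E).tangent.tangent ∞
      (fun q => (⟨q, Z q⟩ : TangentBundle 𝓘(ℝ, E).tangent (TangentBundle 𝓘(ℝ, E) M))) p) :
    lieDerivTensor 𝓘(ℝ, E).tangent (completeLift X) G Y Z p = f p.proj * G p (Y p) (Z p) := by
  obtain ⟨a₁, a₂, a₃, b₁, b₂, b₃, ⟨ha₁, ha₂, ha₃, hb₁, hb₂, hb₃⟩, hG⟩ := hG.exists_eq_naturalForm
  set z := extChartAt 𝓘(ℝ, E).tangent p p with hz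
  have hzp : z = (extChartAt 𝓘(ℝ, E) p.proj p.proj, (p.snd : E)) := extChartAt_tangent_self p
  have hyp : z.1 = extChartAt 𝓘(ℝ, E) p.proj p.proj := congrArg Prod.fst hzp
  have hwp : z.2 = (p.snd : E) := congrArg Prod.snd hzp
  have hy : z.1 ∈ (extChartAt 𝓘(ℝ, E) p.proj).target := hyp ▸ mem_extChartAt_target p.proj
  have hsy : (extChartAt 𝓘(ℝ, E) p.proj).symm z.1 = p.proj := by rw [hyp, extChartAt_to_inv]
  have hev : ∀ᶠ y in 𝓝 z.1, y ∈ (extChartAt 𝓘(ℝ, E) p.proj).target :=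
    (isOpen_extChartAt_target p.proj).mem_nhds hy
  have hev2 : ∀ᶠ z' in 𝓝 z, z'.1 ∈ (extChartAt 𝓘(ℝ, E) p.proj).target :=
    continuousAt_fst.eventually hev
  set γ := metricInChart g p.proj with hγ
  set X' := vectorInChart 𝓘(ℝ, E) p.proj X with hX'
  have h2 : (2 : WithTop ℕ∞) ≤ ∞ := WithTop.coe_le_coe.2 (le_top : (2 : ℕ∞) ≤ ⊤)
  have hγd : ContDiffAt ℝ 2 γ z.1 := (contDiffAt_metricInChart g hy).of_le h2
  have hXd : ContDiffAt ℝ 2 X' z.1 := (contDiffAt_vectorInChart hX hy).of_le h2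
  have hYd := differentiableAt_vectorInChart (hY.mdifferentiableAt (by simp))
  have hZd := differentiableAt_vectorInChart (hZ.mdifferentiableAt (by simp))
  have hΓd := differentiableAt_localChristoffel hγd (isInvertible_metricInChart g hy)
  have hV : vectorInChart 𝓘(ℝ, E).tangent p (completeLift X) =ᶠ[𝓝 z] localCompleteLift X' :=
    hev2.mono fun z' hz' => vectorInChart_completeLift hX hz'
  -- This and the next condition hold on the zero section because they are linear in the fibre
  -- coordinate. If f vanishes identically, this one is trivial and the next is the invariance of
  -- the connection under a Killing field.
  have hc : f p.proj • z.2 = 0 := by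
    rcases hp with hp | hp
    · rw [show z.2 = 0 from hwp.trans hp, smul_zero]
    · rw [hp, zero_smul]
  have hLΓ : ∀ ξ, fderiv ℝ (localChristoffel γ) z.1 (X' z.1) z.2 ξ
      + localChristoffel γ z.1 (fderiv ℝ X' z.1 z.2) ξ
      + localChristoffel γ z.1 z.2 (fderiv ℝ X' z.1 ξ) + fderiv ℝ (fderiv ℝ X') z.1 z.2 ξ
      - fderiv ℝ X' z.1 (localChristoffel γ z.1 z.2 ξ) = 0 := by
    intro ξ
    rcases hp with hp | hp
    · rw [show z.2 = 0 from hwp.trans hp]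
      simp
    · refine lieDeriv_localChristoffel_eq_zero hγd hXd
        (hev.mono fun y hy => isInvertible_metricInChart g hy)
        (Eventually.of_forall fun y => metricInChart_comm g p.proj y)
        (hev.mono fun y hy a b => ?_) z.2 ξ
      rw [localLieDeriv_metricInChart g hX hconf hy, hp, zero_mul]
  have main := hasDirDerivAt_naturalForm (γ := γ) (Γ := localChristoffel γ) (X := X')
    (Y := vectorInChart 𝓘(ℝ, E).tangent p Y)
    (Z := vectorInChart 𝓘(ℝ, E).tangent p Z) (z := z) (c := f p.proj)
    ha₁ ha₂ ha₃ hb₁ hb₂ hb₃ (hγd.differentiableAt two_ne_zero) hΓd hXd hYd hZd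
    (Eventually.of_forall fun y => metricInChart_nonneg g p.proj y)
    (fun a b => by rw [localLieDeriv_metricInChart g hX hconf hy, hsy]) hc hLΓ
  have hF : (fun z => G ((extChartAt 𝓘(ℝ, E).tangent p).symm z)
      (Y ((extChartAt 𝓘(ℝ, E).tangent p).symm z))
      (Z ((extChartAt 𝓘(ℝ, E).tangent p).symm z))) =ᶠ[𝓝 z]
      fun z => naturalForm a₁ a₂ a₃ b₁ b₂ b₃ (γ z.1)
        (localChristoffel γ z.1) z.2 (vectorInChart 𝓘(ℝ, E).tangent p Y z)
        (vectorInChart 𝓘(ℝ, E).tangent p Z z) := by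
    filter_upwards [hev2] with z' hz'
    have hzt : z' ∈ (extChartAt 𝓘(ℝ, E).tangent p).target := by
      rw [extChartAt_tangent_target]; exact ⟨hz', trivial⟩
    rw [← naturalForm_chart hG hz', chartFrame_vectorInChart Y hzt, chartFrame_vectorInChart Z hzt]
  have hGp (ζ ζ' : E × E) : G p ζ ζ' =
      naturalForm a₁ a₂ a₃ b₁ b₂ b₃ (γ z.1) (localChristoffel γ z.1) z.2 ζ ζ' := by
    rw [hyp, hwp]
    exact hG p.proj p.snd ζ ζ'
  rw [lieDerivTensor_eq_chart _ _ _ _ _ (main.1.congr_of_eventuallyEq hF), hF.fderiv_eq]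
  have key : ∀ ζ η ξ : E × E, completeLift X p = ζ → Y p = η → Z p = ξ →
      ζ = localCompleteLift X' z → η = vectorInChart 𝓘(ℝ, E).tangent p Y z →
      ξ = vectorInChart 𝓘(ℝ, E).tangent p Z z →
      fderiv ℝ (fun z => naturalForm a₁ a₂ a₃ b₁ b₂ b₃ (γ z.1)
        (localChristoffel γ z.1) z.2 (vectorInChart 𝓘(ℝ, E).tangent p Y z)
        (vectorInChart 𝓘(ℝ, E).tangent p Z z)) z ζ
      - G p (VectorField.lieBracket ℝ (vectorInChart 𝓘(ℝ, E).tangent p (completeLift X))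
        (vectorInChart 𝓘(ℝ, E).tangent p Y) z : E × E) ξ
      - G p η (VectorField.lieBracket ℝ (vectorInChart 𝓘(ℝ, E).tangent p (completeLift X))
        (vectorInChart 𝓘(ℝ, E).tangent p Z) z : E × E) = f p.proj * G p η ξ := by
    rintro _ _ _ - - - rfl rfl rfl
    rw [main.2, hGp, hGp, hGp, hV.lieBracket_vectorField_eq EventuallyEq.rfl,
      hV.lieBracket_vectorField_eq EventuallyEq.rfl]
    ring
  exact key _ _ _ rfl rfl rfl ((vectorInChart_self (completeLift X) p).symm.trans hV.self_of_nhds)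
    (vectorInChart_self Y p).symm (vectorInChart_self Z p).symm

end Killing

theorem mainTheorem3
    {E : Type*} [NormedAddCommGroup E] [NormedSpace ℝ E] [FiniteDimensional ℝ E] [Nontrivial E]
    {M : Type*} [TopologicalSpace M] [T2Space M] [ChartedSpace E M] [IsManifold 𝓘(ℝ, E) ∞ M]
    (g : Bundle.ContMDiffRiemannianMetric 𝓘(ℝ, E) ∞ E (TangentSpace 𝓘(ℝ, E) : M → Type _))
    (X : ∀ x : M, TangentSpace 𝓘(ℝ, E) x)
    (hX : ContMDiff 𝓘(ℝ, E) 𝓘(ℝ, E).tangent ∞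
      (fun x => (⟨x, X x⟩ : TangentBundle 𝓘(ℝ, E) M)))
    (f : M → ℝ)
    (hconf : LieDerivTensorEq 𝓘(ℝ, E) X g.inner (fun x => f x • g.inner x))
    (G : ∀ p : TangentBundle 𝓘(ℝ, E) M, TangentSpace 𝓘(ℝ, E).tangent p →L[ℝ]
      TangentSpace 𝓘(ℝ, E).tangent p →L[ℝ] ℝ)
    (hG : IsGNatural g G) (hGnd : IsNondegenerateTensor 𝓘(ℝ, E).tangent G) :
    IsKillingField 𝓘(ℝ, E).tangent (completeLift X) G ↔ ∀ x : M, f x = 0 := by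
  constructor
  · intro hK x
    by_contra hfx
    let p : TangentBundle 𝓘(ℝ, E) M := ⟨x, (0 : E)⟩
    -- On the zero section the Lie derivative is f G, so f x ≠ 0 forces G to vanish on all pairs of
    -- vectors at p, each extended to a field smooth at p.
    have hzero : ∀ ζ η : E × E, G p ζ η = 0 := by
      intro ζ η
      have hext (v : E × E) : ∃ Y : ∀ q : TangentBundle 𝓘(ℝ, E) M,
          TangentSpace 𝓘(ℝ, E).tangent q, ContMDiffAt 𝓘(ℝ, E).tangent 𝓘(ℝ, E).tangent.tangent ∞
          (fun q => (⟨q, Y q⟩ :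
            TangentBundle 𝓘(ℝ, E).tangent (TangentBundle 𝓘(ℝ, E) M))) p ∧ Y p = v :=
        ⟨FiberBundle.extend (E × E) (x := p) (E := TangentSpace 𝓘(ℝ, E).tangent) v,
          FiberBundle.contMDiffAt_extend _ _ _, FiberBundle.extend_apply_self _ _⟩
      obtain ⟨Y, hY, rfl⟩ := hext ζ
      obtain ⟨Z, hZ, rfl⟩ := hext η
      have h1 := lieDerivTensor_completeLift hX hconf hG (p := p) (Or.inl rfl) hY hZ
      rw [hK p Y Z hY hZ] at h1
      exact (mul_eq_zero.1 h1.symm).resolve_left hfx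
    obtain ⟨e, he⟩ := exists_ne (0 : E)
    have h2 : ((e, 0) : E × E) = 0 := hGnd p (e, 0) fun η => hzero _ η
    exact he (congrArg Prod.fst h2)
  · intro hf p Y Z hY hZ
    rw [lieDerivTensor_completeLift hX hconf hG (Or.inr hf) hY hZ, hf, zero_mul]
    rfl
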